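/- Let $k$ be a field of characteristic $p$ ($p$ a prime or $p=0$) and let $(V,c)$ be a two-dimensional braided vector space of diagonal type over $k$: $V$ has a basis $x_1,x_2$ with $c(x_i\otimes x_j)=q_{ij}\,x_j\otimes x_i$, $q_{ij}\in k^\times$. Put $q=q_{11}$, $r=q_{12}q_{21}$, $s=q_{22}$, and let $\chi$ be the bicharacter of $\mathbb Z^2$ with $\chi(\alpha_i,\alpha_j)=q_{ij}$, where $\deg x_i=\alpha_i$. Let $\mathcal B(V)$ be the Nichols algebra of $V$, i.e. the quotient of the braided bialgebra $T(V)$ (elements of $V$ primitive) by the sum of all ideals that are coideals and are generated by homogeneous elements of degree $\ge 2$, and let $\pi:T(V)\to\mathcal B(V)$ be the canonical map. Let $d_1$ be the skew-derivation of $T(V)$ with $d_1(x_j)=\delta_{1j}$ and $d_1(yz)=d_1(y)z+\chi(\deg y,\alpha_1)\,y\,d_1(z)$, and let $(\operatorname{ad}x_1)(y)=x_1y-\chi(\alpha_1,\deg y)\,yx_1$ (for homogeneous $y$). For $a\in k$, $n\ge 0$ write $(n)_a=\sum_{i=0}^{n-1}a^i$, $(n)_q^!=\prod_{i=1}^n(i)_q$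 and $b_n=\prod_{i=0}^{n-1}(1-q^ir)$. Let $u_0=x_2$, $u_n=x_1u_{n-1}-q^{n-1}q_{12}u_{n-1}x_1$ for $n\ge 1$, and let $U_n$ and $U_n'$ be the spans of the $u_iu_{n-i}$ with $0\le i\le n$ and with $0\le i\le n-1$, respectively. For $(n)_q^!b_n\neq0$ let $\hat u_n=u_n/((n)_q^!b_n)$ and $$P_n=\sum_{i=0}^n(-q_{21})^iq^{i(i-1)/2}\,\hat u_i\hat u_{n-i}.$$ Define $\mathbb J\subseteq\mathbb N_0$ recursively: $j\in\mathbb J$ if and only if $q^{j(j-1)/2}(-r)^js=-1$ and for every $n\in\mathbb J$ with $n<j$ one has $\left(\frac{j-n}2\right)_{q^{n+j-1}r^2}=0$ if $j-n$ is even, and $(j-n)_{-q^{(n+j-1)/2}r}=0$ if $j-n$ is odd. Let $\mathbb J_1$ be the set of $j\in\mathbb J$ with $q^{n+j-1}r^2\ne1$ for all $n\in\mathbb J$, $n<j$. Let $\mathbb J_2$ be the set of $j\in\mathbb J$ for which there is $n\in\mathbb J$, $n<j$, such that $q^{n+j-1}r^2=1$ and $2p\mid j-n$ if $j-n$ is even,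 and $q^{(n+j-1)/2}r=-1$ and $p\mid j-n$ if $j-n$ is odd. Theorem. Let $m\in\mathbb N_0$ with $(m)_q^!\,b_m\ne0$. (a) For every $n\in\mathbb J_2$ with $n\le m$ there is a unique $j_n\in\mathbb J_1$ with $j_n<n$ and $q^{n+j_n-1}r^2=1$, and there is a unique $L_n\in U_n'\cap\ker\pi$ with $-q_{21}^{-1}d_1(L_n)=(\operatorname{ad}x_1)^{n-j_n-1}(P_{j_n})$. (b) The elements $(\operatorname{ad}x_1)^{m-j}(P_j)$ for $j\in\mathbb J_1\cap[0,m]$, together with $(\operatorname{ad}x_1)^{m-n}(L_n)$ for $n\in\mathbb J_2\cap[0,m]$, form a basis of $\ker(\pi)\cap U_m$. (c) In particular, $\dim(\ker(\pi)\cap U_m)=|\mathbb J\cap[0,m]|$. -/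

import Mathlib

open scoped TensorProduct

noncomputable section

/-- The `q`-number `(n)_q = 1 + q + ⋯ + q^(n-1)`. -/
def qNumber {k : Type*} [Field k] (q : k) (n : ℕ) : k := ∑ i ∈ Finset.range n, q ^ i

/-- The `q`-factorial `(n)_q^! = (1)_q (2)_q ⋯ (n)_q`. -/
def qFactorial {k : Type*} [Field k] (q : k) (n : ℕ) : k :=
  ∏ i ∈ Finset.range n, qNumber q (i + 1)

/-- `b_n = ∏_{i=0}^{n-1} (1 - q^i r)`. -/
def bProd {k : Type*} [Field k] (q r : k) (n : ℕ) : k :=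
  ∏ i ∈ Finset.range n, (1 - q ^ i * r)

/-- A two-dimensional braided vector space of diagonal type `(V, c)` over `k`, together with a
basis diagonalizing the braiding and the braiding matrix. The basis vectors called `x₁, x₂` in
mathematical notation are `x 0, x 1`, and `q_{ij}` is `Q (i-1) (j-1)`. -/
structure DiagonalBraidedPlane (k V : Type*) [Field k] [AddCommGroup V] [Module k V] where
  /-- the braiding -/
  c : V ⊗[k] V →ₗ[k] V ⊗[k] V
  /-- the basis `x₁, x₂` -/
  x : Module.Basis (Fin 2) k V
  /-- the braiding matrix, with nonzero entries -/
  Q : Fin 2 → Fin 2 → kˣ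
  /-- `c (x_i ⊗ x_j) = q_{ij} x_j ⊗ x_i` -/
  c_apply : ∀ i j, c (x i ⊗ₜ[k] x j) = (Q i j : k) • (x j ⊗ₜ[k] x i)

namespace DiagonalBraidedPlane

variable {k V : Type*} [Field k] [AddCommGroup V] [Module k V] (W : DiagonalBraidedPlane k V)

/-- The generator `x_i` of the tensor algebra `T(V)`. -/
def X (i : Fin 2) : TensorAlgebra k V := TensorAlgebra.ι k (W.x i)

/-- The algebra map out of `T(V)` with prescribed values on `x₁, x₂`. -/
def liftX {A : Type*} [Ring A] [Algebra k A] (f : Fin 2 → A) : TensorAlgebra k V →ₐ[k] A :=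
  TensorAlgebra.lift k (W.x.constr k f)

theorem liftX_X {A : Type*} [Ring A] [Algebra k A] (f : Fin 2 → A) (i : Fin 2) :
    W.liftX f (W.X i) = f i := by
  simp [liftX, X]

theorem algHom_ext' {A : Type*} [Ring A] [Algebra k A] {f g : TensorAlgebra k V →ₐ[k] A}
    (h : ∀ i, f (W.X i) = g (W.X i)) : f = g := by
  refine TensorAlgebra.hom_ext (W.x.ext fun i => ?_)
  exact h i

/-- `y ↦ χ(α_i, deg y) y` for homogeneous `y`, as an algebra endomorphism of `T(V)`. -/
def chiLeft (i : Fin 2) : TensorAlgebra k V →ₐ[k] TensorAlgebra k V :=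
  W.liftX fun j => (W.Q i j : k) • W.X j

/-- `y ↦ χ(deg y, α_i) y` for homogeneous `y`, as an algebra endomorphism of `T(V)`. -/
def chiRight (i : Fin 2) : TensorAlgebra k V →ₐ[k] TensorAlgebra k V :=
  W.liftX fun j => (W.Q j i : k) • W.X j

/-! ### The Nichols algebra -/

/-- The left multiplication by the element `Δ(y)` on `T(V) ⊗ T(V)`, the latter with its braided
product `(a ⊗ b) (a' ⊗ b') = χ(deg b, deg a') a a' ⊗ b b'`. For `y = x_i` one has
`Δ(x_i) = x_i ⊗ 1 + 1 ⊗ x_i`, hence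
`Δ(x_i) (a ⊗ b) = x_i a ⊗ b + χ(α_i, deg a) a ⊗ x_i b`. -/
def comulLeft : TensorAlgebra k V →ₐ[k]
    Module.End k (TensorAlgebra k V ⊗[k] TensorAlgebra k V) :=
  W.liftX fun i =>
    TensorProduct.map (LinearMap.mulLeft k (W.X i)) LinearMap.id +
      TensorProduct.map (W.chiLeft i).toLinearMap (LinearMap.mulLeft k (W.X i))

/-- The coproduct `Δ` of the braided bialgebra `T(V)`: the algebra map from `T(V)` to the braided
tensor square of `T(V)` for which the elements of `V` are primitive. -/
def comul : TensorAlgebra k V →ₗ[k] TensorAlgebra k V ⊗[k] TensorAlgebra k V :=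
  (LinearMap.applyₗ (1 ⊗ₜ[k] 1)).comp W.comulLeft.toLinearMap

theorem comul_one : W.comul 1 = 1 ⊗ₜ[k] 1 := by
  simp [comul]

theorem comul_X_mul (i : Fin 2) (y : TensorAlgebra k V) :
    W.comul (W.X i * y) =
      TensorProduct.map (LinearMap.mulLeft k (W.X i)) LinearMap.id (W.comul y) +
        TensorProduct.map (W.chiLeft i).toLinearMap (LinearMap.mulLeft k (W.X i)) (W.comul y) := by
  simp [comul, comulLeft, liftX_X]

theorem comul_X (i : Fin 2) : W.comul (W.X i) = W.X i ⊗ₜ[k] 1 + 1 ⊗ₜ[k] W.X i := by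
  have h := W.comul_X_mul i 1
  simpa [comul_one] using h

/-- `I` is generated by homogeneous elements of degree at least two, and is a coideal:
`Δ(I) ⊆ I ⊗ T(V) + T(V) ⊗ I`. -/
def IsGradedCoideal (I : TwoSidedIdeal (TensorAlgebra k V)) : Prop :=
  (∃ S : Set (TensorAlgebra k V),
    (∀ y ∈ S, ∃ n, 2 ≤ n ∧ y ∈ LinearMap.range (TensorAlgebra.ι k (M := V)) ^ n) ∧
      I = TwoSidedIdeal.span S) ∧
  ∀ y ∈ I, W.comul y ∈
    LinearMap.range (LinearMap.rTensor (TensorAlgebra k V)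
      (I.asIdeal.restrictScalars k).subtype) ⊔
    LinearMap.range (LinearMap.lTensor (TensorAlgebra k V)
      (I.asIdeal.restrictScalars k).subtype)

/-- The defining ideal of the Nichols algebra: the sum of all ideals of `T(V)` which are
generated by homogeneous elements of degree at least two and are coideals. -/
def nicholsIdeal : TwoSidedIdeal (TensorAlgebra k V) :=
  sSup {I | W.IsGradedCoideal I}

/-- The Nichols algebra `B(V)`. -/
abbrev NicholsAlgebra : Type _ := TensorAlgebra k V ⧸ W.nicholsIdeal.asIdeal

/-- The canonical map `π : T(V) → B(V)`. -/
def toNichols : TensorAlgebra k V →ₐ[k] W.NicholsAlgebra :=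
  Ideal.Quotient.mkₐ k W.nicholsIdeal.asIdeal

/-! ### Skew-derivations and the adjoint action -/

/-- The algebra map `y ↦ !![χ(deg y, α_i) y, d_i(y); 0, y]` encoding the skew-derivation `d_i`. -/
def skewMatrix (i : Fin 2) :
    TensorAlgebra k V →ₐ[k] Matrix (Fin 2) (Fin 2) (TensorAlgebra k V) :=
  W.liftX fun j => !![(W.Q j i : k) • W.X j, if i = j then 1 else 0; 0, W.X j]

/-- The skew-derivation `d_i` of `T(V)`, with `d_i(x_j) = δ_{ij}` and
`d_i(y z) = d_i(y) z + χ(deg y, α_i) y d_i(z)`. -/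
def d (i : Fin 2) : TensorAlgebra k V →ₗ[k] TensorAlgebra k V where
  toFun y := W.skewMatrix i y 0 1
  map_add' y z := by simp
  map_smul' a y := by simp

theorem d_X (i j : Fin 2) : W.d i (W.X j) = if i = j then 1 else 0 := by
  simp [d, skewMatrix, liftX_X]

theorem skewMatrix_apply (i : Fin 2) (y : TensorAlgebra k V) :
    W.skewMatrix i y = !![W.chiRight i y, W.d i y; 0, y] := by
  suffices h : W.skewMatrix i y 0 0 = W.chiRight i y ∧ W.skewMatrix i y 1 0 = 0 ∧
      W.skewMatrix i y 1 1 = y by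
    obtain ⟨h₁, h₂, h₃⟩ := h
    ext a b
    fin_cases a <;> fin_cases b <;> simp [h₁, h₂, h₃, d]
  induction y using TensorAlgebra.induction with
  | algebraMap r => simp [Matrix.algebraMap_matrix_apply]
  | ι v =>
    have e (j : Fin 2) : TensorAlgebra.ι k (W.x j) = W.X j := rfl
    obtain ⟨a, b, rfl⟩ : ∃ a b : k, v = a • W.x 0 + b • W.x 1 :=
      ⟨W.x.repr v 0, W.x.repr v 1, by rw [← Fin.sum_univ_two (fun j => W.x.repr v j • W.x j),
        W.x.sum_repr]⟩
    simp [e, skewMatrix, chiRight, liftX_X]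
  | mul a b ha hb =>
    obtain ⟨h₁, h₂, h₃⟩ := ha
    obtain ⟨g₁, g₂, g₃⟩ := hb
    simp [Matrix.mul_apply, h₁, h₂, h₃, g₁, g₂, g₃]
  | add a b ha hb =>
    obtain ⟨h₁, h₂, h₃⟩ := ha
    obtain ⟨g₁, g₂, g₃⟩ := hb
    simp [h₁, h₂, h₃, g₁, g₂, g₃]

theorem d_mul (i : Fin 2) (y z : TensorAlgebra k V) :
    W.d i (y * z) = W.d i y * z + W.chiRight i y * W.d i z := by
  have h := congrFun (congrFun (map_mul (W.skewMatrix i) y z) 0) 1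
  rw [W.skewMatrix_apply i y, W.skewMatrix_apply i z, W.skewMatrix_apply i (y * z)] at h
  simpa [Matrix.mul_apply, add_comm] using h

/-- The adjoint action `(ad x₁)(y) = x₁ y - χ(α₁, deg y) y x₁` on `T(V)`. -/
def adX : Module.End k (TensorAlgebra k V) :=
  LinearMap.mulLeft k (W.X 0) - (LinearMap.mulRight k (W.X 0)).comp (W.chiLeft 0).toLinearMap

/-! ### The elements of degree `m α₁ + 2 α₂` -/

/-- `q = q₁₁` -/
def q : k := W.Q 0 0

/-- `q₁₂` -/
def q12 : k := W.Q 0 1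

/-- `q₂₁` -/
def q21 : k := W.Q 1 0

/-- `r = q₁₂ q₂₁` -/
def r : k := W.q12 * W.q21

/-- `s = q₂₂` -/
def s : k := W.Q 1 1

/-- `u_0 = x₂`, `u_n = x₁ u_{n-1} - q^{n-1} q₁₂ u_{n-1} x₁`. -/
def u : ℕ → TensorAlgebra k V
  | 0 => W.X 1
  | n + 1 => W.X 0 * u n - (W.q ^ n * W.q12) • (u n * W.X 0)

/-- The normalized element `û_n = u_n / ((n)_q^! b_n)`. It is zero if `(n)_q^! b_n = 0`, because
the inverse of zero is zero. -/
def uHat (n : ℕ) : TensorAlgebra k V := (qFactorial W.q n * bProd W.q W.r n)⁻¹ • W.u n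

/-- `U_n`, the span of the products `u_i u_{n-i}`, `0 ≤ i ≤ n`. -/
def U (n : ℕ) : Submodule k (TensorAlgebra k V) :=
  Submodule.span k {y | ∃ i ≤ n, y = W.u i * W.u (n - i)}

/-- `U'_n`, the span of the products `u_i u_{n-i}`, `0 ≤ i ≤ n - 1`. -/
def U' (n : ℕ) : Submodule k (TensorAlgebra k V) :=
  Submodule.span k {y | ∃ i < n, y = W.u i * W.u (n - i)}

/-- `P_n = ∑_{i=0}^n (-q₂₁)^i q^{i(i-1)/2} û_i û_{n-i}`. -/
def P (n : ℕ) : TensorAlgebra k V :=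
  ∑ i ∈ Finset.range (n + 1),
    ((-W.q21) ^ i * W.q ^ (i * (i - 1) / 2)) • (W.uHat i * W.uHat (n - i))

/-- Membership in the set `𝕁`, by recursion: `j ∈ 𝕁` if and only if `q^{j(j-1)/2} (-r)^j s = -1`
and all `n ∈ 𝕁` with `n < j` satisfy `((j-n)/2)_{q^{n+j-1} r²} = 0` if `j - n` is even and
`(j-n)_{-q^{(n+j-1)/2} r} = 0` if `j - n` is odd. -/
def MemJ (j : ℕ) : Prop :=
  W.q ^ (j * (j - 1) / 2) * (-W.r) ^ j * W.s = -1 ∧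
    ∀ n, n < j → MemJ n →
      (Even (j - n) → qNumber (W.q ^ (n + j - 1) * W.r ^ 2) ((j - n) / 2) = 0) ∧
      (Odd (j - n) → qNumber (-(W.q ^ ((n + j - 1) / 2) * W.r)) (j - n) = 0)
termination_by j

/-- The set `𝕁 ⊆ ℕ`. -/
def J : Set ℕ := {j | W.MemJ j}

theorem mem_J_iff (j : ℕ) : j ∈ W.J ↔
    W.q ^ (j * (j - 1) / 2) * (-W.r) ^ j * W.s = -1 ∧
      ∀ n ∈ W.J, n < j →
        (Even (j - n) → qNumber (W.q ^ (n + j - 1) * W.r ^ 2) ((j - n) / 2) = 0) ∧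
        (Odd (j - n) → qNumber (-(W.q ^ ((n + j - 1) / 2) * W.r)) (j - n) = 0) := by
  change W.MemJ j ↔ _
  rw [MemJ]
  exact and_congr_right fun _ => forall_congr' fun n => ⟨fun h a b => h b a, fun h a b => h b a⟩

/-- The set `𝕁₁` of those `j ∈ 𝕁` with `q^{j(j-1)/2} (-r)^j s = -1` and `q^{n+j-1} r² ≠ 1` for
all `n ∈ 𝕁`, `n < j`. -/
def J₁ : Set ℕ :=
  {j | j ∈ W.J ∧ W.q ^ (j * (j - 1) / 2) * (-W.r) ^ j * W.s = -1 ∧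
    ∀ n ∈ W.J, n < j → W.q ^ (n + j - 1) * W.r ^ 2 ≠ 1}

/-- The set `𝕁₂` of those `j ∈ 𝕁` for which there is `n ∈ 𝕁`, `n < j`, such that
`q^{n+j-1} r² = 1` and `2p ∣ j - n` if `j - n` is even, and `q^{(n+j-1)/2} r = -1` and `p ∣ j - n`
if `j - n` is odd, where `p` is the characteristic of `k`. -/
def J₂ : Set ℕ :=
  {j | j ∈ W.J ∧ ∃ n ∈ W.J, n < j ∧
    (Even (j - n) → W.q ^ (n + j - 1) * W.r ^ 2 = 1 ∧ 2 * ringChar k ∣ j - n) ∧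
    (Odd (j - n) → W.q ^ ((n + j - 1) / 2) * W.r = -1 ∧ ringChar k ∣ j - n)}

/-- The relation between `n ∈ 𝕁₂` and `j = j_n`: `j ∈ 𝕁₁`, `j < n` and `q^{n+j-1} r² = 1`. -/
def IsPartner (n j : ℕ) : Prop :=
  j ∈ W.J₁ ∧ j < n ∧ W.q ^ (n + j - 1) * W.r ^ 2 = 1

/-- The defining property of the element `L_n`: `L ∈ U'_n ∩ ker π` and
`-q₂₁⁻¹ d₁(L) = (ad x₁)^{n-j_n-1}(P_{j_n})`. -/
def IsL (n : ℕ) (L : TensorAlgebra k V) : Prop :=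
  L ∈ W.U' n ∧ W.toNichols L = 0 ∧
    ∃ j, W.IsPartner n j ∧ (-W.q21⁻¹) • W.d 0 L = (W.adX ^ (n - j - 1)) (W.P j)

end DiagonalBraidedPlane

end

noncomputable section

namespace DiagonalBraidedPlane

variable {k V : Type*} [Field k] [AddCommGroup V] [Module k V] (W : DiagonalBraidedPlane k V)

/-! ### Skew-derivations and the coproduct of the tensor algebra -/

/-! The kernel of `π` consists of the elements on which every iterated skew-derivation followed by
the counit vanishes (`nicholsIdeal_eq_radicalIdeal`). Hence an element without constant term is a
relation exactly when its images under `d 0` and `d 1` (that is, d₁ and d₂) are relations. For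
(n)_q^! b_n ≠ 0 the products û_i û_{n-i} are linearly independent (`theta_eq_zero`). In these
coordinates d₁ becomes the two-term operator `tau`, ad x₁ becomes `alpha`, and d₂ sees only the
first and last coordinate. So a vector is a relation iff its d₁-image is one and a single linear
equation between its end coordinates holds. The kernel of d₁ on U_n is the line through P_n, so each
degree adds at most one dimension to the d₁-image.

The commutation rule d₁ ∘ ad x₁ = (1 - q^{2n} r²) + q (ad x₁ ∘ d₁) on U_n (`tau_alpha`) shows that
d₁ maps (ad x₁)^{n-j}(P_j) to a multiple of (ad x₁)^{n-j-1}(P_j). In the range n ≤ m the factor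
vanishes exactly when q^{n+j-1} r² = 1, that is, when j is the partner of n. Then (ad x₁)^{n-j}(P_j)
is itself a nonzero multiple of P_n, so P_n gives nothing new, and (ad x₁)^{n-j-1}(P_j) needs
another d₁-preimage among the relations. That preimage is L_n up to a scalar. The obstruction to its
existence is the linear form `psi`, whose value is, up to nonzero factors, the q-number in the
definition of 𝕁 (`psi_betaSeq_eq_zero_iff`). Thus n with a partner lies in 𝕁 iff L_n exists, and n
without a partner lies in 𝕁 iff P_n is a relation (`mem_J_iff_of_isPartner`).

Nonvanishing of (m)_q^! makes partners unique. An induction along d₁ then shows that the proposed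
family spans the relations (`relations_le_span_family`) and is independent (`linearIndepOn_family`).
-/

theorem exists_ι_eq (v : V) :
    ∃ a : Fin 2 → k, TensorAlgebra.ι k v = ∑ i, a i • W.X i :=
  ⟨fun i => W.x.repr v i, by
    conv_lhs => rw [← W.x.sum_repr v]
    simp only [map_sum, map_smul, X]⟩

/-- The shape matches `d_X_mul` and `comul_X_mul`, which are recursions in left multiplication by a
generator. -/
theorem induction_X_mul {p : TensorAlgebra k V → Prop} (one : p 1)
    (smul : ∀ (a : k) y, p y → p (a • y)) (add : ∀ y z, p y → p z → p (y + z))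
    (X_mul : ∀ i y, p y → p (W.X i * y)) (y : TensorAlgebra k V) : p y := by
  suffices h : ∀ z, p z → p (y * z) by simpa using h 1 one
  induction y using TensorAlgebra.induction with
  | algebraMap a => intro z hz; rw [← Algebra.smul_def]; exact smul a z hz
  | ι v =>
    intro z hz
    obtain ⟨a, ha⟩ := W.exists_ι_eq v
    rw [ha, Fin.sum_univ_two, add_mul, smul_mul_assoc, smul_mul_assoc]
    exact add _ _ (smul _ _ (X_mul _ _ hz)) (smul _ _ (X_mul _ _ hz))
  | mul a b ha hb => intro z hz; rw [mul_assoc]; exact ha _ (hb _ hz)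
  | add a b ha hb => intro z hz; rw [add_mul]; exact add _ _ (ha _ hz) (hb _ hz)

theorem chiLeft_X (i j : Fin 2) : W.chiLeft i (W.X j) = (W.Q i j : k) • W.X j :=
  W.liftX_X _ _

theorem chiRight_X (i j : Fin 2) : W.chiRight i (W.X j) = (W.Q j i : k) • W.X j :=
  W.liftX_X _ _

theorem d_one (i : Fin 2) : W.d i 1 = 0 := by
  have h := W.skewMatrix_apply i 1
  rw [map_one] at h
  simpa using (congrFun (congrFun h 0) 1).symm

theorem d_algebraMap (i : Fin 2) (a : k) : W.d i (algebraMap k _ a) = 0 := by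
  rw [Algebra.algebraMap_eq_smul_one, map_smul, W.d_one, smul_zero]

theorem d_X_mul (i j : Fin 2) (y : TensorAlgebra k V) :
    W.d i (W.X j * y) = (if i = j then y else 0) + (W.Q j i : k) • (W.X j * W.d i y) := by
  rw [W.d_mul, W.d_X, W.chiRight_X, smul_mul_assoc, ite_mul, one_mul, zero_mul]

theorem d_chiRight (i j : Fin 2) (y : TensorAlgebra k V) :
    W.d j (W.chiRight i y) = (W.Q j i : k) • W.chiRight i (W.d j y) := by
  induction y using W.induction_X_mul with
  | one => simp [W.d_one]
  | smul a y h => simp only [map_smul, h, smul_comm a]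
  | add y z h h' => simp only [map_add, h, h', smul_add]
  | X_mul l y h =>
    rw [map_mul, W.chiRight_X, smul_mul_assoc, map_smul, W.d_X_mul, h, W.d_X_mul, map_add,
      map_smul, map_mul, W.chiRight_X]
    by_cases e : j = l
    · subst e
      simp only [if_true, smul_mul_assoc, mul_smul_comm, smul_add, smul_smul]
    · simp only [if_neg e, smul_mul_assoc, mul_smul_comm, smul_smul, zero_add, map_zero]
      congr 1
      ring

theorem d_chiLeft (i j : Fin 2) (y : TensorAlgebra k V) :
    W.d j (W.chiLeft i y) = (W.Q i j : k) • W.chiLeft i (W.d j y) := by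
  induction y using W.induction_X_mul with
  | one => simp [W.d_one]
  | smul a y h => simp only [map_smul, h, smul_comm a]
  | add y z h h' => simp only [map_add, h, h', smul_add]
  | X_mul l y h =>
    rw [map_mul, W.chiLeft_X, smul_mul_assoc, map_smul, W.d_X_mul, h, W.d_X_mul, map_add,
      map_smul, map_mul, W.chiLeft_X]
    by_cases e : j = l
    · subst e
      simp only [if_true, smul_mul_assoc, mul_smul_comm, smul_add, smul_smul]
    · simp only [if_neg e, smul_mul_assoc, mul_smul_comm, smul_smul, zero_add, map_zero]
      congr 1
      ring

/-- The skew-derivations act on the left tensor factor of the coproduct. -/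
theorem comul_d (i : Fin 2) (y : TensorAlgebra k V) :
    LinearMap.rTensor _ (W.d i) (W.comul y) = W.comul (W.d i y) := by
  induction y using W.induction_X_mul with
  | one => simp [W.comul_one, W.d_one]
  | smul a y h => simp only [map_smul, h]
  | add y z h h' => simp only [map_add, h, h']
  | X_mul j y h =>
    -- The coproduct of `y` is not a pure tensor, so the commutation is shown for arbitrary `t`.
    have key : ∀ t : TensorAlgebra k V ⊗[k] TensorAlgebra k V,
        LinearMap.rTensor _ (W.d i)
          (TensorProduct.map (LinearMap.mulLeft k (W.X j)) LinearMap.id t +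
            TensorProduct.map (W.chiLeft j).toLinearMap (LinearMap.mulLeft k (W.X j)) t) =
        (if i = j then t else 0) + (W.Q j i : k) •
          (TensorProduct.map (LinearMap.mulLeft k (W.X j)) LinearMap.id
              (LinearMap.rTensor _ (W.d i) t) +
            TensorProduct.map (W.chiLeft j).toLinearMap (LinearMap.mulLeft k (W.X j))
              (LinearMap.rTensor _ (W.d i) t)) := by
      intro t
      induction t with
      | zero => simp
      | tmul a b =>
        simp only [TensorProduct.map_tmul, LinearMap.mulLeft_apply, LinearMap.id_apply, map_add,
          LinearMap.rTensor_tmul, AlgHom.toLinearMap_apply, W.d_X_mul, W.d_chiLeft,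
          TensorProduct.add_tmul, TensorProduct.smul_tmul', smul_add]
        split_ifs <;> simp [add_assoc]
      | add s t hs ht =>
        simp only [map_add, smul_add] at hs ht ⊢
        rw [add_add_add_comm, hs, ht]
        split_ifs <;> simp <;> abel
    rw [W.comul_X_mul, key, h, W.d_X_mul, map_add, map_smul, W.comul_X_mul]
    split_ifs <;> simp

theorem algebraMapInv_X (i : Fin 2) : TensorAlgebra.algebraMapInv (W.X i) = 0 := by
  simp [X, TensorAlgebra.algebraMapInv]

/-- The left counit law. The counit kills `X j` and is unchanged by `chiLeft`, so only the second
summand of `comul_X_mul` survives. -/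
theorem algebraMapInv_comul (y : TensorAlgebra k V) :
    TensorProduct.lid k _ (LinearMap.rTensor _ TensorAlgebra.algebraMapInv.toLinearMap
      (W.comul y)) = y := by
  induction y using W.induction_X_mul with
  | one => simp [W.comul_one]
  | smul a y h => simp only [map_smul, h]
  | add y z h h' => simp only [map_add, h, h']
  | X_mul j y h =>
    have key : ∀ t : TensorAlgebra k V ⊗[k] TensorAlgebra k V,
        TensorProduct.lid k _ (LinearMap.rTensor _ TensorAlgebra.algebraMapInv.toLinearMap
          (TensorProduct.map (LinearMap.mulLeft k (W.X j)) LinearMap.id t +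
            TensorProduct.map (W.chiLeft j).toLinearMap (LinearMap.mulLeft k (W.X j)) t)) =
        W.X j * TensorProduct.lid k _
          (LinearMap.rTensor _ TensorAlgebra.algebraMapInv.toLinearMap t) := by
      have e (a : TensorAlgebra k V) :
          TensorAlgebra.algebraMapInv (W.chiLeft j a) = TensorAlgebra.algebraMapInv a := by
        suffices TensorAlgebra.algebraMapInv.comp (W.chiLeft j) = TensorAlgebra.algebraMapInv from
          DFunLike.congr_fun this a
        refine W.algHom_ext' fun i => ?_
        simp [W.chiLeft_X, W.algebraMapInv_X]
      intro t
      induction t with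
      | zero => simp
      | tmul a b => simp [W.algebraMapInv_X, e]
      | add s t hs ht =>
        simp only [map_add, mul_add] at hs ht ⊢
        rw [add_add_add_comm, hs, ht]
    rw [W.comul_X_mul, key, h]

/-- The iterated skew-derivation along a word. -/
def dWord (w : List (Fin 2)) : Module.End k (TensorAlgebra k V) :=
  w.foldl (fun f i => W.d i ∘ₗ f) LinearMap.id

theorem dWord_nil (y : TensorAlgebra k V) : W.dWord [] y = y := rfl

theorem dWord_cons (i : Fin 2) (w : List (Fin 2)) (y : TensorAlgebra k V) :
    W.dWord (i :: w) y = W.dWord w (W.d i y) := by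
  suffices h : ∀ (f : Module.End k (TensorAlgebra k V)),
      w.foldl (fun f i => W.d i ∘ₗ f) f = W.dWord w ∘ₗ f by
    rw [dWord, List.foldl_cons, h]
    rfl
  unfold dWord
  induction w using List.reverseRecOn with
  | nil => intro f; rfl
  | append_singleton w j ih => intro f; simp only [List.foldl_append, ih f]; rfl

/-- The value of the counit at the iterated skew-derivation along a word. -/
def wordForm (w : List (Fin 2)) : TensorAlgebra k V →ₗ[k] k :=
  TensorAlgebra.algebraMapInv.toLinearMap ∘ₗ W.dWord w

theorem wordForm_nil (y : TensorAlgebra k V) :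
    W.wordForm [] y = TensorAlgebra.algebraMapInv y := rfl

theorem wordForm_cons (i : Fin 2) (w : List (Fin 2)) (y : TensorAlgebra k V) :
    W.wordForm (i :: w) y = W.wordForm w (W.d i y) :=
  congrArg TensorAlgebra.algebraMapInv (W.dWord_cons i w y)

/-- The bridge between coideals and skew-derivations: the iterated derivatives are recovered from
the coproduct by functionals on its left factor. -/
theorem wordForm_comul (w : List (Fin 2)) (y : TensorAlgebra k V) :
    TensorProduct.lid k _ (LinearMap.rTensor _ (W.wordForm w) (W.comul y)) = W.dWord w y := by
  induction w generalizing y with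
  | nil => exact W.algebraMapInv_comul y
  | cons i w ih =>
    have : W.wordForm (i :: w) = W.wordForm w ∘ₗ W.d i := LinearMap.ext (W.wordForm_cons i w)
    rw [this, LinearMap.rTensor_comp_apply, W.comul_d, ih, W.dWord_cons]

/-! ### The defining ideal of the Nichols algebra in terms of skew-derivations -/

/-- A word form sees only the part of one multidegree, on which `chiRight` is a scalar. This makes
the radical stable under right multiplication. -/
theorem wordForm_chiRight (w : List (Fin 2)) (i : Fin 2) :
    ∃ a : k, ∀ y, W.wordForm w (W.chiRight i y) = a * W.wordForm w y := by
  induction w with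
  | nil =>
    refine ⟨1, fun y => ?_⟩
    rw [one_mul, wordForm_nil, wordForm_nil]
    suffices TensorAlgebra.algebraMapInv.comp (W.chiRight i) = TensorAlgebra.algebraMapInv from
      DFunLike.congr_fun this y
    refine W.algHom_ext' fun i => ?_
    simp [W.chiRight_X, W.algebraMapInv_X]
  | cons j w ih =>
    obtain ⟨a, ha⟩ := ih
    refine ⟨W.Q j i * a, fun y => ?_⟩
    rw [W.wordForm_cons, W.d_chiRight, map_smul, ha, W.wordForm_cons, smul_eq_mul, mul_assoc]

/-- The elements on which all iterated skew-derivations followed by the counit vanish. -/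
def radicalIdeal : TwoSidedIdeal (TensorAlgebra k V) :=
  TwoSidedIdeal.mk' {y | ∀ w, W.wordForm w y = 0}
    (fun w => map_zero _)
    (fun hx hy w => by rw [map_add, hx, hy, add_zero])
    (fun hx w => by rw [map_neg, hx, neg_zero])
    (fun {a y} hy w => by
      induction w generalizing a y with
      | nil =>
        have h := hy []
        rw [wordForm_nil] at h ⊢
        rw [map_mul, h, mul_zero]
      | cons i w ih =>
        have h : ∀ w, W.wordForm w (W.d i y) = 0 := fun w => W.wordForm_cons i w y ▸ hy (i :: w)
        rw [W.wordForm_cons, W.d_mul, map_add, ih hy, ih h, add_zero])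
    (fun {y a} hy w => by
      induction w generalizing a y with
      | nil =>
        have h := hy []
        rw [wordForm_nil] at h ⊢
        rw [map_mul, h, zero_mul]
      | cons i w ih =>
        have h : ∀ w, W.wordForm w (W.d i y) = 0 := fun w => W.wordForm_cons i w y ▸ hy (i :: w)
        have h' : ∀ w, W.wordForm w (W.chiRight i y) = 0 := fun w => by
          obtain ⟨c, hc⟩ := W.wordForm_chiRight w i
          rw [hc, hy w, mul_zero]
        rw [W.wordForm_cons, W.d_mul, map_add, ih h, ih h', add_zero])

theorem mem_radicalIdeal {y : TensorAlgebra k V} :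
    y ∈ W.radicalIdeal ↔ ∀ w, W.wordForm w y = 0 :=
  TwoSidedIdeal.mem_mk' ..

theorem d_mem_radicalIdeal {y : TensorAlgebra k V} (hy : y ∈ W.radicalIdeal) (i : Fin 2) :
    W.d i y ∈ W.radicalIdeal :=
  W.mem_radicalIdeal.2 fun w => W.wordForm_cons i w y ▸ W.mem_radicalIdeal.1 hy (i :: w)

theorem mem_radicalIdeal_iff_d {y : TensorAlgebra k V} :
    y ∈ W.radicalIdeal ↔
      TensorAlgebra.algebraMapInv y = 0 ∧ ∀ i, W.d i y ∈ W.radicalIdeal := by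
  refine ⟨fun h => ⟨W.mem_radicalIdeal.1 h [], W.d_mem_radicalIdeal h⟩, fun h => ?_⟩
  refine W.mem_radicalIdeal.2 fun w => ?_
  cases w with
  | nil => exact h.1
  | cons i w => rw [W.wordForm_cons]; exact W.mem_radicalIdeal.1 (h.2 i) w

/-- The second conjunct compensates for `0 - 1 = 0`: without it the term `X j * d i y` with `y` of
degree zero could not be placed in the right degree. -/
theorem d_mem_range_pow (i : Fin 2) (n : ℕ) {y : TensorAlgebra k V}
    (hy : y ∈ LinearMap.range (TensorAlgebra.ι k (M := V)) ^ n) :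
    W.d i y ∈ LinearMap.range (TensorAlgebra.ι k (M := V)) ^ (n - 1) ∧ (n = 0 → W.d i y = 0) := by
  induction hy using Submodule.pow_induction_on_left' with
  | algebraMap a => simp [W.d_algebraMap]
  | add y z n hy hz h h' =>
    rw [map_add]
    exact ⟨add_mem h.1 h'.1, fun e => by rw [h.2 e, h'.2 e, add_zero]⟩
  | mem_mul v hv n y hy h =>
    refine ⟨?_, by simp⟩
    obtain ⟨v, rfl⟩ := hv
    obtain ⟨a, ha⟩ := W.exists_ι_eq v
    simp only [ha, Finset.sum_mul, map_sum, smul_mul_assoc, map_smul, W.d_X_mul]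
    refine sum_mem fun j _ => Submodule.smul_mem _ _ (add_mem ?_ (Submodule.smul_mem _ _ ?_))
    · split_ifs
      · simpa using hy
      · exact zero_mem _
    · obtain rfl | hn := Nat.eq_zero_or_pos n
      · rw [h.2 rfl, mul_zero]
        exact zero_mem _
      · obtain ⟨n, rfl⟩ := Nat.exists_eq_succ_of_ne_zero hn.ne'
        rw [show n.succ.succ - 1 = n + 1 from rfl, pow_succ']
        exact Submodule.mul_mem_mul ⟨_, rfl⟩ h.1

theorem wordForm_eq_zero_of_mem_range_pow {n : ℕ} {w : List (Fin 2)} (hw : w.length ≠ n)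
    {y : TensorAlgebra k V} (hy : y ∈ LinearMap.range (TensorAlgebra.ι k (M := V)) ^ n) :
    W.wordForm w y = 0 := by
  induction w generalizing n y with
  | nil =>
    obtain ⟨n, rfl⟩ := Nat.exists_eq_succ_of_ne_zero (fun e : n = 0 => hw e.symm)
    rw [pow_succ'] at hy
    rw [wordForm_nil]
    refine Submodule.mul_induction_on hy ?_ ?_
    · rintro _ ⟨v, rfl⟩ z -
      simp [TensorAlgebra.algebraMapInv]
    · intro y z hy hz
      rw [map_add, hy, hz, add_zero]
  | cons i w ih =>
    rw [W.wordForm_cons]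
    obtain ⟨h, h'⟩ := W.d_mem_range_pow i n hy
    obtain rfl | hn := Nat.eq_zero_or_pos n
    · rw [h' rfl, map_zero]
    · exact ih (fun e => hw (by rw [List.length_cons, e]; omega)) h

/-- Expanding along a basis of `N` turns `t` into a family of vectors of `M`, and the functionals
`f` separate the points of `M`. -/
theorem eq_zero_of_forall_rTensor_eq_zero {M N ι : Type*} [AddCommGroup M] [AddCommGroup N]
    [Module k M] [Module k N] (f : ι → M →ₗ[k] k) (hf : ∀ x, (∀ i, f i x = 0) → x = 0)
    (t : M ⊗[k] N) (ht : ∀ i, LinearMap.rTensor N (f i) t = 0) : t = 0 := by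
  classical
  let b := Module.Basis.ofVectorSpace k N
  have key : ∀ i (t : M ⊗[k] N) j, f i (TensorProduct.equivFinsuppOfBasisRight b t j) =
      b.repr (TensorProduct.lid k N (LinearMap.rTensor N (f i) t)) j := by
    intro i t j
    induction t with
    | zero => simp
    | tmul x y =>
      rw [TensorProduct.equivFinsuppOfBasisRight_apply_tmul_apply, LinearMap.rTensor_tmul,
        TensorProduct.lid_tmul, map_smul, map_smul, Finsupp.smul_apply, smul_eq_mul, smul_eq_mul,
        mul_comm]
    | add s t hs ht => simp only [map_add, Finsupp.add_apply, hs, ht]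
  rw [← (TensorProduct.equivFinsuppOfBasisRight b).map_eq_zero_iff]
  refine Finsupp.ext fun j => hf _ fun i => ?_
  rw [key, ht, map_zero, map_zero, Finsupp.zero_apply]

/-- A word form sees only the degree equal to its length, so the radical contains the homogeneous
components of its elements, and those of degree 0 and 1 vanish. -/
theorem radicalIdeal_isGradedCoideal : W.IsGradedCoideal W.radicalIdeal := by
  classical
  let 𝒜 : ℕ → Submodule k (TensorAlgebra k V) :=
    fun n => LinearMap.range (TensorAlgebra.ι k (M := V)) ^ n
  have hproj : ∀ y ∈ W.radicalIdeal, ∀ n, (DirectSum.decompose 𝒜 y n : TensorAlgebra k V) ∈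
      W.radicalIdeal := by
    intro y hy n
    rw [W.mem_radicalIdeal] at hy ⊢
    intro w
    by_cases e : w.length = n
    · rw [← hy w]
      conv_rhs => rw [← DirectSum.sum_support_decompose 𝒜 y, map_sum]
      by_cases hn : n ∈ (DirectSum.decompose 𝒜 y).support
      · rw [Finset.sum_eq_single_of_mem n hn]
        intro b _ hb
        exact W.wordForm_eq_zero_of_mem_range_pow (fun e' => hb (e'.symm.trans e))
          (DirectSum.decompose 𝒜 y b).2
      · rw [DFinsupp.notMem_support_iff.1 hn]
        simp only [ZeroMemClass.coe_zero, map_zero]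
        refine (Finset.sum_eq_zero fun b hb => ?_).symm
        exact W.wordForm_eq_zero_of_mem_range_pow
          (fun e' => hn (by rwa [← e, e'])) (DirectSum.decompose 𝒜 y b).2
    · exact W.wordForm_eq_zero_of_mem_range_pow e (DirectSum.decompose 𝒜 y n).2
  have hlow : ∀ n, n < 2 → ∀ y ∈ 𝒜 n, y ∈ W.radicalIdeal → y = 0 := by
    intro n hn y hy h
    rw [W.mem_radicalIdeal] at h
    interval_cases n
    · obtain ⟨a, rfl⟩ := Submodule.mem_one.1 (by simpa [𝒜] using hy)
      have := h []
      rw [wordForm_nil, AlgHom.commutes] at this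
      rw [show a = 0 from this, map_zero]
    · obtain ⟨v, rfl⟩ : y ∈ LinearMap.range (TensorAlgebra.ι k (M := V)) := by simpa [𝒜] using hy
      obtain ⟨a, ha⟩ := W.exists_ι_eq v
      rw [ha] at h ⊢
      refine Finset.sum_eq_zero fun i _ => ?_
      have := h [i]
      rw [W.wordForm_cons, wordForm_nil] at this
      simp only [map_sum, map_smul, W.d_X, smul_eq_mul, apply_ite, map_one, map_zero, mul_one,
        mul_zero, Finset.sum_ite_eq, Finset.mem_univ, if_true] at this
      rw [this, zero_smul]
  refine ⟨⟨{y | y ∈ W.radicalIdeal ∧ ∃ n, 2 ≤ n ∧ y ∈ 𝒜 n}, fun y hy => hy.2, ?_⟩, ?_⟩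
  · refine le_antisymm (fun y hy => ?_) (TwoSidedIdeal.span_le.2 fun y hy => hy.1)
    rw [← DirectSum.sum_support_decompose 𝒜 y]
    refine sum_mem fun n _ => ?_
    by_cases hn : 2 ≤ n
    · exact TwoSidedIdeal.subset_span ⟨hproj y hy n, n, hn, (DirectSum.decompose 𝒜 y n).2⟩
    · rw [hlow n (by omega) _ (DirectSum.decompose 𝒜 y n).2 (hproj y hy n)]
      exact zero_mem _
  · intro y hy
    set I : Submodule k (TensorAlgebra k V) := W.radicalIdeal.asIdeal.restrictScalars k with hI
    have memI : ∀ z, z ∈ I ↔ ∀ w, W.wordForm w z = 0 := fun z => by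
      rw [hI, Submodule.restrictScalars_mem, TwoSidedIdeal.mem_asIdeal, W.mem_radicalIdeal]
    have hex : Function.Exact I.subtype I.mkQ :=
      LinearMap.exact_iff.2 (by rw [Submodule.ker_mkQ, Submodule.range_subtype])
    -- The space I ⊗ T + T ⊗ I is the kernel of T ⊗ T → T/I ⊗ T/I. Vanishing there is tested with
    -- the word forms on the left factor, which leaves the classes of the iterated derivatives of
    -- `y`.
    rw [sup_comm, ← TensorProduct.map_ker hex I.mkQ_surjective hex I.mkQ_surjective,
      LinearMap.mem_ker]
    let F (w : List (Fin 2)) : TensorAlgebra k V ⧸ I →ₗ[k] k :=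
      I.liftQ (W.wordForm w) fun z hz => (memI z).1 hz w
    have hF : ∀ w z, F w (I.mkQ z) = W.wordForm w z := fun w z => rfl
    refine eq_zero_of_forall_rTensor_eq_zero F (fun z hz => ?_) _ fun w => ?_
    · obtain ⟨z, rfl⟩ := I.mkQ_surjective z
      exact (Submodule.Quotient.mk_eq_zero _).2 ((memI z).2 hz)
    have hF' : ∀ t : TensorAlgebra k V ⊗[k] TensorAlgebra k V,
        TensorProduct.lid k _ (LinearMap.rTensor _ (F w) (TensorProduct.map I.mkQ I.mkQ t)) =
          I.mkQ (TensorProduct.lid k _ (LinearMap.rTensor _ (W.wordForm w) t)) := by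
      intro t
      induction t with
      | zero => simp only [map_zero]
      | tmul a b =>
        rw [TensorProduct.map_tmul, LinearMap.rTensor_tmul, LinearMap.rTensor_tmul,
          TensorProduct.lid_tmul, TensorProduct.lid_tmul, hF, map_smul]
      | add s t hs ht => simp only [map_add, hs, ht]
    rw [← (TensorProduct.lid k _).map_eq_zero_iff, hF', W.wordForm_comul]
    refine (Submodule.Quotient.mk_eq_zero _).2 ((memI _).2 (W.mem_radicalIdeal.1 ?_))
    clear hF'
    induction w generalizing y with
    | nil => exact hy
    | cons i w ih => rw [W.dWord_cons]; exact ih _ (W.d_mem_radicalIdeal hy i)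

/-- Generators of degree at least two are killed by word forms of length below two, and so is the
ideal they generate. Applying the form of length one to the left factor of Δ(I) kills I ⊗ T and
sends T ⊗ I into I, so I is stable under every `d i`. -/
theorem IsGradedCoideal.le_radicalIdeal {I : TwoSidedIdeal (TensorAlgebra k V)}
    (hI : W.IsGradedCoideal I) : I ≤ W.radicalIdeal := by
  obtain ⟨⟨S, hS, rfl⟩, hΔ⟩ := hI
  have hlow : ∀ w : List (Fin 2), w.length < 2 → ∀ y ∈ TwoSidedIdeal.span S,
      W.wordForm w y = 0 := by
    let K : TwoSidedIdeal (TensorAlgebra k V) :=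
      TwoSidedIdeal.mk' {y | W.wordForm [] y = 0 ∧ ∀ i, W.wordForm [i] y = 0}
        ⟨map_zero _, fun i => map_zero _⟩
        (fun hx hy => ⟨by rw [map_add, hx.1, hy.1, add_zero],
          fun i => by rw [map_add, hx.2, hy.2, add_zero]⟩)
        (fun hx => ⟨by rw [map_neg, hx.1, neg_zero], fun i => by rw [map_neg, hx.2, neg_zero]⟩)
        (fun {a y} hy => by
          have h₁ := hy.1
          have h₂ := hy.2
          simp only [wordForm_nil, wordForm_cons] at h₁ h₂
          constructor
          · rw [wordForm_nil, map_mul, h₁, mul_zero]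
          · intro i
            rw [W.wordForm_cons, wordForm_nil, W.d_mul, map_add, map_mul, map_mul, h₁, h₂,
              mul_zero, mul_zero, add_zero])
        (fun {y a} hy => by
          have h₁ := hy.1
          have h₂ := hy.2
          have h₃ (i : Fin 2) : W.wordForm [] (W.chiRight i y) = 0 := by
            obtain ⟨c, hc⟩ := W.wordForm_chiRight [] i
            rw [hc, h₁, mul_zero]
          simp only [wordForm_nil, wordForm_cons] at h₁ h₂ h₃
          constructor
          · rw [wordForm_nil, map_mul, h₁, zero_mul]
          · intro i
            rw [W.wordForm_cons, wordForm_nil, W.d_mul, map_add, map_mul, map_mul, h₂, h₃,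
              zero_mul, zero_mul, add_zero])
    have hle : TwoSidedIdeal.span S ≤ K := by
      refine TwoSidedIdeal.span_le.2 fun y hy => ?_
      obtain ⟨n, hn, hyn⟩ := hS y hy
      refine (TwoSidedIdeal.mem_mk' ..).2 ⟨?_, fun i => ?_⟩ <;>
        refine W.wordForm_eq_zero_of_mem_range_pow ?_ hyn
      · simp only [List.length_nil]
        omega
      · simp only [List.length_singleton]
        omega
    intro w hw y hy
    have h := (TwoSidedIdeal.mem_mk' ..).1 (hle hy)
    match w, hw with
    | [], _ => exact h.1
    | [i], _ => exact h.2 i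
  have hd : ∀ y ∈ TwoSidedIdeal.span S, ∀ i, W.d i y ∈ TwoSidedIdeal.span S := by
    intro y hy i
    have h := W.wordForm_comul [i] y
    rw [W.dWord_cons, W.dWord_nil] at h
    rw [← h, ← TwoSidedIdeal.mem_asIdeal, ← Submodule.restrictScalars_mem k]
    obtain ⟨s, ⟨s, rfl⟩, t, ⟨t, rfl⟩, hst⟩ := Submodule.mem_sup.1 (hΔ y hy)
    rw [← hst, map_add, map_add]
    clear hst
    refine add_mem ?_ ?_
    · induction s with
      | zero => simp
      | tmul a b => simp [hlow [i] (by simp) a (TwoSidedIdeal.mem_asIdeal.1 a.2)]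
      | add s t hs ht => simp only [map_add]; exact add_mem hs ht
    · induction t with
      | zero => simp
      | tmul a b =>
        simp only [LinearMap.lTensor_tmul, LinearMap.rTensor_tmul, TensorProduct.lid_tmul]
        exact Submodule.smul_mem _ _ b.2
      | add s t hs ht => simp only [map_add]; exact add_mem hs ht
  intro y hy
  refine W.mem_radicalIdeal.2 fun w => ?_
  induction w generalizing y with
  | nil => exact hlow [] (by simp) y hy
  | cons i w ih => rw [W.wordForm_cons]; exact ih (hd y hy i)

theorem nicholsIdeal_eq_radicalIdeal : W.nicholsIdeal = W.radicalIdeal :=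
  le_antisymm (sSup_le fun _ hI => IsGradedCoideal.le_radicalIdeal W hI)
    (le_sSup W.radicalIdeal_isGradedCoideal)

theorem toNichols_eq_zero_iff {y : TensorAlgebra k V} :
    W.toNichols y = 0 ↔ y ∈ W.radicalIdeal := by
  rw [← W.nicholsIdeal_eq_radicalIdeal, ← TwoSidedIdeal.mem_asIdeal]
  exact Ideal.Quotient.eq_zero_iff_mem

theorem toNichols_d {y : TensorAlgebra k V} (hy : W.toNichols y = 0) (i : Fin 2) :
    W.toNichols (W.d i y) = 0 :=
  W.toNichols_eq_zero_iff.2 (W.d_mem_radicalIdeal (W.toNichols_eq_zero_iff.1 hy) i)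

theorem toNichols_eq_zero_iff_d {y : TensorAlgebra k V} :
    W.toNichols y = 0 ↔
      TensorAlgebra.algebraMapInv y = 0 ∧ ∀ i, W.toNichols (W.d i y) = 0 := by
  simp only [W.toNichols_eq_zero_iff]
  exact W.mem_radicalIdeal_iff_d

end DiagonalBraidedPlane

end

noncomputable section

namespace DiagonalBraidedPlane

/-! ### Coordinate sequences -/

section Sequences

variable {R : Type*} [CommRing R] (q a b : R)

/-- The scalar `(n)_q (1 - q^(n-1) ρ)`. -/
def cCoef (q ρ : R) (n : ℕ) : R := (∑ i ∈ Finset.range n, q ^ i) * (1 - q ^ (n - 1) * ρ)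

theorem cCoef_zero (ρ : R) : cCoef q ρ 0 = 0 := by simp [cCoef]

/-- This recursion is the one produced by commuting d₁ past x₁. It yields both d₁(u_n) and the
derivatives of powers of ad x₁. -/
theorem cCoef_succ (ρ : R) (n : ℕ) :
    cCoef q ρ (n + 1) = 1 - q ^ (2 * n) * ρ + q * cCoef q ρ n := by
  cases n with
  | zero => simp [cCoef]
  | succ n =>
    have h₁ := Finset.sum_range_succ' (fun i => q ^ i) (n + 1)
    have h₂ := Finset.sum_range_succ (fun i => q ^ i) (n + 1)
    rw [h₁] at h₂
    simp only [pow_succ, ← Finset.sum_mul, pow_zero] at h₂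
    simp only [cCoef, Nat.add_sub_cancel, Finset.sum_range_succ _ (n + 1)]
    linear_combination (-1 : R) * h₂

/-- The coefficients `(-b)^i q^(i(i-1)/2)`. -/
def eSeq (i : ℕ) : R := (-b) ^ i * q ^ (i * (i - 1) / 2)

theorem eSeq_zero : eSeq q b 0 = 1 := by simp [eSeq]

theorem eSeq_succ (i : ℕ) : eSeq q b (i + 1) = -(q ^ i * b) * eSeq q b i := by
  have h : (i + 1) * (i + 1 - 1) / 2 = i * (i - 1) / 2 + i := by
    rw [← Finset.sum_range_id_mul_two, ← Finset.sum_range_id_mul_two,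
      Nat.mul_div_cancel _ two_pos, Nat.mul_div_cancel _ two_pos, Finset.sum_range_succ]
  rw [eSeq, h, eSeq]
  ring

/-- The action of the first skew-derivation on coordinates. -/
def tau (f : ℕ → R) (i : ℕ) : R := f (i + 1) + q ^ i * b * f i

/-- The adjoint action of `x₁` on coordinates. -/
def alpha (n : ℕ) (f : ℕ → R) (i : ℕ) : R :=
  cCoef q (a * b) i * f (i - 1) + q ^ i * a * cCoef q (a * b) (n - i) * f i

theorem tau_eSeq (i : ℕ) : tau q b (eSeq q b) i = 0 := by
  rw [tau, eSeq_succ]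
  ring

/-- The out-of-range entries, `f (0 - 1)` at `i = 0` and `f n` at `i = n`, carry the factor `cCoef q
(a * b) 0 = 0`. -/
theorem alpha_congr {n : ℕ} {f g : ℕ → R} (h : ∀ i < n, f i = g i) {i : ℕ} (hi : i ≤ n) :
    alpha q a b n f i = alpha q a b n g i := by
  have h₁ : cCoef q (a * b) i * f (i - 1) = cCoef q (a * b) i * g (i - 1) := by
    cases i with
    | zero => rw [cCoef_zero, zero_mul, zero_mul]
    | succ i => rw [Nat.add_sub_cancel, h i (by omega)]
  have h₂ : cCoef q (a * b) (n - i) * f i = cCoef q (a * b) (n - i) * g i := by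
    obtain rfl | hi := hi.eq_or_lt
    · rw [Nat.sub_self, cCoef_zero, zero_mul, zero_mul]
    · rw [h i hi]
  rw [alpha, alpha, h₁, mul_assoc _ (cCoef q (a * b) (n - i)), h₂, mul_assoc _ _ (g i)]

/-- The commutation rule of d₁ and ad x₁ in coordinates, with `a`, `b` standing for q₁₂, q₂₁. -/
theorem tau_alpha (n : ℕ) (f : ℕ → R) {i : ℕ} (hi : i ≤ n) :
    tau q b (alpha q a b (n + 1) f) i =
      (1 - q ^ (2 * n) * (a * b) ^ 2) * f i + q * alpha q a b n (tau q b f) i := by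
  obtain ⟨l, rfl⟩ := Nat.exists_eq_add_of_le hi
  have e₁ : i + l + 1 - (i + 1) = l := by omega
  have e₂ : i + l + 1 - i = l + 1 := by omega
  simp only [tau, alpha, e₁, e₂, Nat.add_sub_cancel, Nat.add_sub_cancel_left]
  have h₁ := cCoef_succ q (a * b) i
  have h₂ := cCoef_succ q (a * b) l
  cases i with
  | zero =>
    simp only [cCoef_zero] at h₁ ⊢
    rw [h₁, h₂]
    ring
  | succ i =>
    simp only [Nat.add_sub_cancel]
    rw [h₁, h₂]
    ring

/-- The coordinates of `(ad x₁)^t (P_j)`. -/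
def betaSeq (j : ℕ) : ℕ → ℕ → R
  | 0 => eSeq q b
  | t + 1 => alpha q a b (j + t + 1) (betaSeq j t)

/-- Starting from `tau_eSeq`, the scalars of `tau_alpha` accumulate by `cCoef_succ` with ρ = q^{2j}
r². -/
theorem tau_betaSeq_succ (j t : ℕ) {i : ℕ} (hi : i ≤ j + t) :
    tau q b (betaSeq q a b j (t + 1)) i =
      cCoef q (q ^ (2 * j) * (a * b) ^ 2) (t + 1) * betaSeq q a b j t i := by
  induction t generalizing i with
  | zero =>
    rw [betaSeq, betaSeq, add_zero, tau_alpha q a b j _ hi, betaSeq,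
      alpha_congr q a b (n := j) (g := 0) (fun i _ => tau_eSeq q b i) hi]
    simp [alpha, cCoef]
  | succ t ih =>
    rw [betaSeq, tau_alpha q a b _ _ hi,
      alpha_congr q a b
        (g := fun i => cCoef q (q ^ (2 * j) * (a * b) ^ 2) (t + 1) * betaSeq q a b j t i)
        (fun i h => ih (by omega)) hi, cCoef_succ _ _ (t + 1), add_mul]
    have : betaSeq q a b j (t + 1) i = alpha q a b (j + (t + 1)) (betaSeq q a b j t) i := rfl
    rw [this, alpha, alpha]
    ring

theorem betaSeq_zero (j t : ℕ) :
    betaSeq q a b j t 0 = ∏ l ∈ Finset.range t, (a * cCoef q (a * b) (j + l + 1)) := by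
  induction t with
  | zero => exact eSeq_zero q b
  | succ t ih =>
    rw [Finset.prod_range_succ, ← ih, betaSeq, alpha, cCoef_zero, Nat.sub_zero]
    ring

theorem betaSeq_last (j t : ℕ) :
    betaSeq q a b j t (j + t) =
      (∏ l ∈ Finset.range t, cCoef q (a * b) (j + l + 1)) * eSeq q b j := by
  induction t with
  | zero => simp [betaSeq]
  | succ t ih =>
    rw [Finset.prod_range_succ, betaSeq, alpha, add_assoc j t 1, Nat.sub_self, cCoef_zero,
      ← add_assoc, Nat.add_sub_cancel, ih]
    ring

/-- The products `∏_{i ≤ l < n} (-q^l b)`. -/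
def tailProd (n i : ℕ) : R := ∏ l ∈ Finset.Ico i n, -(q ^ l * b)

theorem tailProd_eq {n i : ℕ} (h : i < n) :
    tailProd q b n i = -(q ^ i * b) * tailProd q b n (i + 1) := by
  rw [tailProd, Finset.prod_eq_prod_Ico_succ_bot h, tailProd]

theorem eSeq_mul_tailProd {n i : ℕ} (h : i ≤ n) :
    eSeq q b i * tailProd q b n i = eSeq q b n := by
  induction n, h using Nat.le_induction with
  | base => simp [tailProd]
  | succ n h ih =>
    rw [tailProd, Finset.prod_Ico_succ_top h, eSeq_succ, ← ih, tailProd]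
    ring

/-- The linear form whose vanishing allows to lift a sequence along `tau` to a sequence whose
first and last entries vanish. -/
def psi (n : ℕ) (f : ℕ → R) : R := ∑ i ∈ Finset.range n, tailProd q b n (i + 1) * f i

theorem psi_congr {n : ℕ} {f g : ℕ → R} (h : ∀ i < n, f i = g i) : psi q b n f = psi q b n g :=
  Finset.sum_congr rfl fun i hi => by rw [h i (Finset.mem_range.1 hi)]

/-- The weights `tailProd` make the sum telescope. A `tau`-lift of `g` with first entry 0 therefore
has last entry `psi q b n g`. -/
theorem psi_tau (n : ℕ) (f : ℕ → R) : psi q b n (tau q b f) = f n - eSeq q b n * f 0 := by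
  have h : ∀ i ∈ Finset.range n, tailProd q b n (i + 1) * tau q b f i =
      tailProd q b n (i + 1) * f (i + 1) - tailProd q b n i * f i := by
    intro i hi
    rw [tailProd_eq q b (Finset.mem_range.1 hi), tau]
    ring
  rw [psi, Finset.sum_congr rfl h, Finset.sum_range_sub (fun i => tailProd q b n i * f i),
    ← eSeq_mul_tailProd q b (Nat.zero_le n), eSeq_zero, one_mul]
  simp [tailProd]

/-- Up to the factor on the left, `betaSeq` is `tau` of its successor, so `psi` reduces to the two
end entries. That factor can vanish, precisely in the case of interest, so dividing by it requires a
generic parameter. -/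
theorem psi_betaSeq (j t : ℕ) :
    cCoef q (q ^ (2 * j) * (a * b) ^ 2) (t + 1) * psi q b (j + t + 1) (betaSeq q a b j t) =
      (∏ l ∈ Finset.range (t + 1), cCoef q (a * b) (j + l + 1)) * eSeq q b j *
        (1 - ∏ l ∈ Finset.Ico j (j + t + 1), -(q ^ l * (a * b))) := by
  have h₁ : cCoef q (q ^ (2 * j) * (a * b) ^ 2) (t + 1) *
      psi q b (j + t + 1) (betaSeq q a b j t) =
      psi q b (j + t + 1) (tau q b (betaSeq q a b j (t + 1))) := by
    rw [psi, psi, Finset.mul_sum]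
    refine Finset.sum_congr rfl fun i hi => ?_
    rw [tau_betaSeq_succ q a b j t (by have := Finset.mem_range.1 hi; omega)]
    ring
  have h₂ : ∏ l ∈ Finset.Ico j (j + t + 1), -(q ^ l * (a * b)) =
      a ^ (t + 1) * tailProd q b (j + t + 1) j := by
    have : ∀ l ∈ Finset.Ico j (j + t + 1), -(q ^ l * (a * b)) = a * -(q ^ l * b) :=
      fun l _ => by ring
    rw [Finset.prod_congr rfl this, Finset.prod_mul_distrib, Finset.prod_const, Nat.card_Ico,
      tailProd, show j + t + 1 - j = t + 1 by omega]
  rw [h₁, psi_tau, h₂, ← eSeq_mul_tailProd q b (show j ≤ j + t + 1 by omega), add_assoc j t 1,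
    betaSeq_last, betaSeq_zero, Finset.prod_mul_distrib, Finset.prod_const, Finset.card_range]
  ring

theorem prod_Ico_neg_pow_of_even (ρ : R) (j h : ℕ) :
    ∏ l ∈ Finset.Ico j (j + 2 * (h + 1)), -(q ^ l * ρ) =
      (q ^ (2 * j + 2 * h + 1) * ρ ^ 2) ^ (h + 1) := by
  rw [Finset.prod_Ico_eq_prod_range, Nat.add_sub_cancel_left]
  have : ∀ l ∈ Finset.range (2 * (h + 1)), -(q ^ (j + l) * ρ) = q ^ l * (-(q ^ j * ρ)) :=
    fun l _ => by ring
  rw [Finset.prod_congr rfl this, Finset.prod_mul_distrib, Finset.prod_pow_eq_pow_sum,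
    Finset.prod_const, Finset.card_range, Finset.sum_range_id, mul_assoc,
    Nat.mul_div_cancel_left _ two_pos, pow_mul (-_) 2, neg_sq, mul_comm (h + 1), pow_mul,
    ← mul_pow, show 2 * (h + 1) - 1 = 2 * h + 1 by omega]
  congr 1
  ring

theorem prod_Ico_neg_pow_of_odd (ρ : R) (j h : ℕ) :
    ∏ l ∈ Finset.Ico j (j + (2 * h + 1)), -(q ^ l * ρ) = (-(q ^ (j + h) * ρ)) ^ (2 * h + 1) := by
  rw [Finset.prod_Ico_eq_prod_range, Nat.add_sub_cancel_left]
  have : ∀ l ∈ Finset.range (2 * h + 1), -(q ^ (j + l) * ρ) = q ^ l * (-(q ^ j * ρ)) :=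
    fun l _ => by ring
  rw [Finset.prod_congr rfl this, Finset.prod_mul_distrib, Finset.prod_pow_eq_pow_sum,
    Finset.prod_const, Finset.card_range, Finset.sum_range_id, Nat.add_sub_cancel,
    mul_left_comm, Nat.mul_div_cancel_left _ two_pos, mul_comm, pow_mul' q, ← mul_pow]
  congr 1
  ring

end Sequences

/-! ### Specialization of the coordinate identities along ring homomorphisms. -/

section Map

variable {R S : Type*} [CommRing R] [CommRing S] (φ : R →+* S) (q a b : R)

theorem map_cCoef (ρ : R) (n : ℕ) : φ (cCoef q ρ n) = cCoef (φ q) (φ ρ) n := by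
  simp [cCoef]

theorem map_eSeq (n : ℕ) : φ (eSeq q b n) = eSeq (φ q) (φ b) n := by
  simp [eSeq]

theorem map_betaSeq (j t i : ℕ) : φ (betaSeq q a b j t i) = betaSeq (φ q) (φ a) (φ b) j t i := by
  induction t generalizing i with
  | zero => exact map_eSeq φ q b i
  | succ t ih => simp [betaSeq, alpha, ih, map_cCoef]

theorem map_psi (n : ℕ) (f : ℕ → R) : φ (psi q b n f) = psi (φ q) (φ b) n fun i => φ (f i) := by
  simp [psi, tailProd]

end Map

/-! ### Evaluation of the obstruction over a field. -/

section Field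

variable {k : Type*} [Field k] (q a b : k)

open Polynomial in
-- With `a` replaced by an indeterminate, 1 - Y for Y = q^{2j+2h+1}(ab)² is a nonzero common factor
-- of both sides of `psi_betaSeq`, the product there being Y^{h+1}. It is cancelled before `a` is
-- specialized.
theorem psi_betaSeq_of_even (j h : ℕ) :
    (∑ i ∈ Finset.range (2 * h + 2), q ^ i) *
        psi q b (j + (2 * h + 1) + 1) (betaSeq q a b j (2 * h + 1)) =
      (∏ l ∈ Finset.range (2 * h + 2), cCoef q (a * b) (j + l + 1)) * eSeq q b j *
        ∑ i ∈ Finset.range (h + 1), (q ^ (2 * j + 2 * h + 1) * (a * b) ^ 2) ^ i := by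
  have key := psi_betaSeq (C q) (Polynomial.X : k[X]) (C b) j (2 * h + 1)
  rw [show j + (2 * h + 1) + 1 = j + 2 * (h + 1) by ring, prod_Ico_neg_pow_of_even,
    ← mul_neg_geom_sum, cCoef, Nat.add_sub_cancel] at key
  have hne : (1 - C q ^ (2 * j + 2 * h + 1) * (Polynomial.X * C b) ^ 2 : k[X]) ≠ 0 := fun e => by
    simpa using congrArg (Polynomial.eval 0) e
  have := congrArg (Polynomial.evalRingHom a) (mul_left_cancel₀ hne
    (b := (∑ i ∈ Finset.range (2 * h + 2), C q ^ i) *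
        psi (C q) (C b) (j + 2 * (h + 1)) (betaSeq (C q) Polynomial.X (C b) j (2 * h + 1)))
    (c := (∏ l ∈ Finset.range (2 * h + 2), cCoef (C q) (Polynomial.X * C b) (j + l + 1)) *
      eSeq (C q) (C b) j * ∑ i ∈ Finset.range (h + 1),
        (C q ^ (2 * j + 2 * h + 1) * (Polynomial.X * C b) ^ 2) ^ i) (by
      rw [mul_left_comm _ (_ * _) (Finset.sum _ _), ← key]
      ring))
  rw [show j + (2 * h + 1) + 1 = j + 2 * (h + 1) by ring]
  simpa only [map_mul, map_sum, map_prod, map_sub, map_one, map_neg, map_pow, map_psi,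
    map_betaSeq, map_cCoef, map_eSeq, Polynomial.coe_evalRingHom, Polynomial.eval_C,
    Polynomial.eval_X] using this

open Polynomial in
-- With z = q^{j+h} ab the left factor is (1 - z)(1 + z) and the right one is 1 - (-z)^{2h+1}. Only
-- 1 + z is cancelled, again for an indeterminate `a`, and 1 - z stays.
theorem psi_betaSeq_of_odd (j h : ℕ) :
    (∑ i ∈ Finset.range (2 * h + 1), q ^ i) * (1 - q ^ (j + h) * (a * b)) *
        psi q b (j + 2 * h + 1) (betaSeq q a b j (2 * h)) =
      (∏ l ∈ Finset.range (2 * h + 1), cCoef q (a * b) (j + l + 1)) * eSeq q b j *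
        ∑ i ∈ Finset.range (2 * h + 1), (-(q ^ (j + h) * (a * b))) ^ i := by
  have key := psi_betaSeq (C q) (Polynomial.X : k[X]) (C b) j (2 * h)
  rw [add_assoc j, prod_Ico_neg_pow_of_odd, ← mul_neg_geom_sum, cCoef] at key
  have hne : (1 - -(C q ^ (j + h) * (Polynomial.X * C b)) : k[X]) ≠ 0 := fun e => by
    simpa using congrArg (Polynomial.eval 0) e
  have := congrArg (Polynomial.evalRingHom a) (mul_left_cancel₀ hne
    (b := (∑ i ∈ Finset.range (2 * h + 1), C q ^ i) *
      (1 - C q ^ (j + h) * (Polynomial.X * C b)) *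
        psi (C q) (C b) (j + (2 * h + 1)) (betaSeq (C q) Polynomial.X (C b) j (2 * h)))
    (c := (∏ l ∈ Finset.range (2 * h + 1), cCoef (C q) (Polynomial.X * C b) (j + l + 1)) *
      eSeq (C q) (C b) j * ∑ i ∈ Finset.range (2 * h + 1),
        (-(C q ^ (j + h) * (Polynomial.X * C b))) ^ i) (by
      rw [mul_left_comm _ (_ * _) (Finset.sum _ _), ← key, Nat.add_sub_cancel]
      ring))
  rw [add_assoc j]
  simpa only [map_mul, map_sum, map_prod, map_sub, map_one, map_neg, map_pow, map_psi,
    map_betaSeq, map_cCoef, map_eSeq, Polynomial.coe_evalRingHom, Polynomial.eval_C,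
    Polynomial.eval_X] using this

theorem eSeq_ne_zero {q b : k} (hq : q ≠ 0) (hb : b ≠ 0) (n : ℕ) : eSeq q b n ≠ 0 :=
  mul_ne_zero (pow_ne_zero _ (neg_ne_zero.2 hb)) (pow_ne_zero _ hq)

/-- All other factors of the two evaluations divide nonzero `cCoef`s or powers of `q` and `b`. This
is the origin of the recursive condition defining 𝕁. -/
theorem psi_betaSeq_eq_zero_iff {q a b : k} (hq : q ≠ 0) (hb : b ≠ 0) {j n : ℕ} (hjn : j < n)
    (hc : ∀ l < n, cCoef q (a * b) (l + 1) ≠ 0) :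
    psi q b n (betaSeq q a b j (n - j - 1)) = 0 ↔
      (Even (n - j) → qNumber (q ^ (j + n - 1) * (a * b) ^ 2) ((n - j) / 2) = 0) ∧
      (Odd (n - j) → qNumber (-(q ^ ((j + n - 1) / 2) * (a * b))) (n - j) = 0) := by
  obtain ⟨t, rfl⟩ := Nat.exists_eq_add_of_lt hjn
  have hB : (∏ l ∈ Finset.range (t + 1), cCoef q (a * b) (j + l + 1)) * eSeq q b j ≠ 0 :=
    mul_ne_zero (Finset.prod_ne_zero_iff.2 fun l hl => hc _ (by
      have := Finset.mem_range.1 hl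
      omega)) (eSeq_ne_zero hq hb j)
  have hN : ∑ i ∈ Finset.range (t + 1), q ^ i ≠ 0 := left_ne_zero_of_mul (hc t (by omega))
  have e₁ : j + t + 1 - j = t + 1 := by omega
  obtain ⟨h, rfl | rfl⟩ := Nat.even_or_odd' t
  · have key := psi_betaSeq_of_odd q a b j h
    have h₁ : 1 - q ^ (j + h) * (a * b) ≠ 0 := right_ne_zero_of_mul (hc (j + h) (by omega))
    have e₂ : (j + (j + 2 * h + 1) - 1) / 2 = j + h := by omega
    rw [e₁, Nat.add_sub_cancel, e₂, qNumber, qNumber]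
    have he : ¬ Even (2 * h + 1) := by simp
    simp only [he, false_imp_iff, true_and, even_two_mul, Even.add_one, true_imp_iff]
    refine ⟨fun e => ?_, fun e => ?_⟩
    · rw [e, mul_zero, eq_comm] at key
      exact (mul_eq_zero.1 key).resolve_left hB
    · rw [e, mul_zero] at key
      exact (mul_eq_zero.1 key).resolve_left (mul_ne_zero hN h₁)
  · have key := psi_betaSeq_of_even q a b j h
    have e₂ : j + (j + (2 * h + 1) + 1) - 1 = 2 * j + 2 * h + 1 := by omega
    have e₃ : (2 * h + 1 + 1) / 2 = h + 1 := by omega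
    rw [e₁, Nat.add_sub_cancel, e₂, e₃, qNumber, qNumber]
    have he : Even (2 * h + 1 + 1) := by simp [Nat.even_add_one]
    have ho : ¬ Odd (2 * h + 1 + 1) := by simpa using he
    simp only [he, ho, false_imp_iff, and_true, true_imp_iff]
    refine ⟨fun e => ?_, fun e => ?_⟩
    · rw [e, mul_zero, eq_comm] at key
      exact (mul_eq_zero.1 key).resolve_left hB
    · rw [e, mul_zero] at key
      exact (mul_eq_zero.1 key).resolve_left hN

end Field

end DiagonalBraidedPlane

end

noncomputable section

namespace DiagonalBraidedPlane

variable {k V : Type*} [Field k] [AddCommGroup V] [Module k V] (W : DiagonalBraidedPlane k V)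

/-! ### The elements `u_n` -/

theorem q_ne_zero : W.q ≠ 0 := (W.Q 0 0).ne_zero

theorem q12_ne_zero : W.q12 ≠ 0 := (W.Q 0 1).ne_zero

theorem q21_ne_zero : W.q21 ≠ 0 := (W.Q 1 0).ne_zero

theorem chiLeft_u (n : ℕ) : W.chiLeft 0 (W.u n) = (W.q ^ n * W.q12) • W.u n := by
  induction n with
  | zero => rw [u, W.chiLeft_X, pow_zero, one_mul]; rfl
  | succ n ih =>
    have e : (W.Q 0 0 : k) = W.q := rfl
    rw [u, map_sub, map_smul, map_mul, map_mul, ih, W.chiLeft_X, e, smul_sub]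
    simp only [smul_mul_assoc, mul_smul_comm, smul_smul]
    congr 2 <;> ring

theorem chiRight_u (i : Fin 2) (n : ℕ) :
    W.chiRight i (W.u n) = ((W.Q 0 i : k) ^ n * W.Q 1 i) • W.u n := by
  induction n with
  | zero => rw [u, W.chiRight_X, pow_zero, one_mul]
  | succ n ih =>
    rw [u, map_sub, map_smul, map_mul, map_mul, ih, W.chiRight_X, smul_sub]
    simp only [smul_mul_assoc, mul_smul_comm, smul_smul]
    congr 2 <;> ring

theorem d_zero_u_zero : W.d 0 (W.u 0) = 0 := by simp [u, W.d_X]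

theorem d_one_u_zero : W.d 1 (W.u 0) = 1 := by simp [u, W.d_X]

theorem d_zero_u_succ (n : ℕ) : W.d 0 (W.u (n + 1)) = cCoef W.q W.r (n + 1) • W.u n := by
  have e : (W.Q 0 0 : k) = W.q := rfl
  have e' : (W.Q 1 0 : k) = W.q21 := rfl
  have hd : W.d 0 (W.u (n + 1)) = W.u n + W.q • (W.X 0 * W.d 0 (W.u n)) -
      (W.q ^ n * W.q12) • (W.d 0 (W.u n) * W.X 0) -
      (W.q ^ (2 * n) * W.r) • W.u n := by
    rw [u, map_sub, map_smul, W.d_X_mul, W.d_mul, W.d_X, W.chiRight_u, e, e', if_pos rfl,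
      if_pos rfl, mul_one, smul_add, smul_smul, sub_sub]
    congr 3
    rw [r]
    ring
  rw [hd]
  cases n with
  | zero => simp [W.d_zero_u_zero, cCoef, sub_smul]
  | succ n =>
    rw [cCoef_succ, d_zero_u_succ n, add_smul, sub_smul, one_smul, mul_smul W.q]
    have hu : W.u (n + 1) = W.X 0 * W.u n - (W.q ^ n * W.q12) • (W.u n * W.X 0) := rfl
    conv_rhs => enter [2]; rw [hu]
    simp only [smul_mul_assoc, mul_smul_comm, smul_sub, smul_smul]
    rw [show W.q ^ (n + 1) * W.q12 * cCoef W.q W.r (n + 1) =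
      W.q * (cCoef W.q W.r (n + 1) * (W.q ^ n * W.q12)) by ring]
    abel

theorem d_one_u_succ (n : ℕ) : W.d 1 (W.u (n + 1)) = 0 := by
  have e : (W.Q 0 1 : k) = W.q12 := rfl
  rw [u, map_sub, map_smul, W.d_X_mul, W.d_mul, W.d_X, if_neg (by decide), if_neg (by decide),
    mul_zero, add_zero, zero_add, e]
  cases n with
  | zero => rw [W.d_one_u_zero, mul_one, one_mul, pow_zero, one_mul, sub_self]
  | succ n => rw [d_one_u_succ n, mul_zero, zero_mul, smul_zero, smul_zero, sub_self]

theorem adX_apply (y : TensorAlgebra k V) :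
    W.adX y = W.X 0 * y - W.chiLeft 0 y * W.X 0 := rfl

theorem adX_mul (y z : TensorAlgebra k V) :
    W.adX (y * z) = W.adX y * z + W.chiLeft 0 y * W.adX z := by
  simp only [adX_apply, map_mul, sub_mul, mul_sub, mul_assoc]
  abel

theorem adX_u (n : ℕ) : W.adX (W.u n) = W.u (n + 1) := by
  rw [adX_apply, W.chiLeft_u, smul_mul_assoc, u]

theorem algebraMapInv_u (n : ℕ) : TensorAlgebra.algebraMapInv (W.u n) = 0 := by
  cases n with
  | zero => exact W.algebraMapInv_X 1
  | succ n => rw [u, map_sub, map_smul, map_mul, map_mul, W.algebraMapInv_X]; simp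

/-! ### The normalized elements -/

/-- The scalar `(n)_q^! b_n`. -/
def norm (n : ℕ) : k := qFactorial W.q n * bProd W.q W.r n

theorem norm_zero : W.norm 0 = 1 := by simp [norm, qFactorial, bProd]

theorem norm_succ (n : ℕ) : W.norm (n + 1) = W.norm n * cCoef W.q W.r (n + 1) := by
  rw [norm, qFactorial, bProd, Finset.prod_range_succ, Finset.prod_range_succ, norm, qFactorial,
    bProd, cCoef, qNumber, Nat.add_sub_cancel]
  ring

variable {W} in
theorem norm_ne_zero_of_le {m n : ℕ} (hm : W.norm m ≠ 0) (h : n ≤ m) : W.norm n ≠ 0 := by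
  induction m, h using Nat.le_induction with
  | base => exact hm
  | succ m h ih => exact ih (left_ne_zero_of_mul (W.norm_succ m ▸ hm))

variable {W} in
theorem cCoef_ne_zero {m n : ℕ} (hm : W.norm m ≠ 0) (h : n < m) :
    cCoef W.q W.r (n + 1) ≠ 0 :=
  right_ne_zero_of_mul (W.norm_succ n ▸ norm_ne_zero_of_le hm h)

theorem uHat_eq (n : ℕ) : W.uHat n = (W.norm n)⁻¹ • W.u n := rfl

theorem uHat_zero : W.uHat 0 = W.u 0 := by rw [uHat_eq, norm_zero, inv_one, one_smul]

theorem d_zero_uHat_zero : W.d 0 (W.uHat 0) = 0 := by rw [uHat_zero, d_zero_u_zero]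

theorem d_one_uHat_zero : W.d 1 (W.uHat 0) = 1 := by rw [uHat_zero, d_one_u_zero]

theorem d_one_uHat_succ (n : ℕ) : W.d 1 (W.uHat (n + 1)) = 0 := by
  rw [uHat_eq, map_smul, d_one_u_succ, smul_zero]

variable {W} in
-- The purpose of the normalization: the scalar of `d_zero_u_succ` is the quotient of consecutive
-- values of `norm`.
theorem d_zero_uHat_succ {n : ℕ} (hn : W.norm (n + 1) ≠ 0) :
    W.d 0 (W.uHat (n + 1)) = W.uHat n := by
  rw [uHat_eq, map_smul, d_zero_u_succ, smul_smul, uHat_eq]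
  rw [norm_succ] at hn ⊢
  rw [mul_inv, inv_mul_cancel_right₀ (right_ne_zero_of_mul hn)]

variable {W} in
theorem adX_uHat {n : ℕ} (hn : W.norm (n + 1) ≠ 0) :
    W.adX (W.uHat n) = cCoef W.q W.r (n + 1) • W.uHat (n + 1) := by
  rw [uHat_eq, uHat_eq, map_smul, adX_u, smul_smul]
  rw [norm_succ] at hn ⊢
  rw [mul_inv, mul_comm _ (_ * _), inv_mul_cancel_right₀ (right_ne_zero_of_mul hn)]

theorem chiLeft_uHat (n : ℕ) : W.chiLeft 0 (W.uHat n) = (W.q ^ n * W.q12) • W.uHat n := by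
  rw [uHat_eq, map_smul, chiLeft_u, smul_comm]

theorem chiRight_uHat (i : Fin 2) (n : ℕ) :
    W.chiRight i (W.uHat n) = ((W.Q 0 i : k) ^ n * W.Q 1 i) • W.uHat n := by
  rw [uHat_eq, map_smul, chiRight_u, smul_comm]

variable {W} in
-- Applying d₁ `n` times and then d₂ leads to 1.
theorem toNichols_uHat_ne_zero {n : ℕ} (hn : W.norm n ≠ 0) : W.toNichols (W.uHat n) ≠ 0 := by
  induction n with
  | zero =>
    intro h
    have h₁ := W.toNichols_d h 1
    rw [d_one_uHat_zero, W.toNichols_eq_zero_iff, W.mem_radicalIdeal] at h₁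
    exact one_ne_zero ((map_one TensorAlgebra.algebraMapInv).symm.trans (h₁ []))
  | succ n ih =>
    intro h
    have h₁ := W.toNichols_d h 0
    rw [d_zero_uHat_succ hn] at h₁
    exact ih (norm_ne_zero_of_le hn n.le_succ) h₁

/-! ### Skew-derivations, adjoint action and relations in coordinates on `U_n`. -/

/-- The element of `U_n` with given coordinates with respect to the products `û_i û_{n-i}`. -/
def theta (n : ℕ) : (ℕ → k) →ₗ[k] TensorAlgebra k V :=
  ∑ i ∈ Finset.range (n + 1), (LinearMap.proj i).smulRight (W.uHat i * W.uHat (n - i))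

theorem theta_apply (n : ℕ) (f : ℕ → k) :
    W.theta n f = ∑ i ∈ Finset.range (n + 1), f i • (W.uHat i * W.uHat (n - i)) := by
  simp [theta]

theorem theta_congr {n : ℕ} {f g : ℕ → k} (h : ∀ i ≤ n, f i = g i) :
    W.theta n f = W.theta n g := by
  rw [theta_apply, theta_apply]
  exact Finset.sum_congr rfl fun i hi => by rw [h i (by have := Finset.mem_range.1 hi; omega)]

theorem P_eq_theta (n : ℕ) : W.P n = W.theta n (eSeq W.q W.q21) := by
  rw [theta_apply]
  rfl

theorem d_zero_theta_zero (f : ℕ → k) : W.d 0 (W.theta 0 f) = 0 := by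
  simp [theta_apply, W.d_mul, d_zero_uHat_zero]

variable {W} in
theorem d_zero_theta_succ {n : ℕ} (hn : W.norm (n + 1) ≠ 0) (f : ℕ → k) :
    W.d 0 (W.theta (n + 1) f) = W.theta n (tau W.q W.q21 f) := by
  have e : (W.Q 0 0 : k) = W.q := rfl
  have e' : (W.Q 1 0 : k) = W.q21 := rfl
  simp only [theta_apply, map_sum, map_smul, W.d_mul, chiRight_uHat, smul_add,
    Finset.sum_add_distrib, e, e', tau, add_smul]
  congr 1
  · rw [Finset.sum_range_succ', d_zero_uHat_zero, zero_mul, smul_zero, add_zero]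
    refine Finset.sum_congr rfl fun i hi => ?_
    have := Finset.mem_range.1 hi
    rw [d_zero_uHat_succ (norm_ne_zero_of_le hn (by omega)), Nat.add_sub_add_right]
  · rw [Finset.sum_range_succ, Nat.sub_self, d_zero_uHat_zero, mul_zero, smul_zero, add_zero]
    refine Finset.sum_congr rfl fun i hi => ?_
    have := Finset.mem_range.1 hi
    rw [Nat.sub_add_comm (by omega), d_zero_uHat_succ (norm_ne_zero_of_le hn (by omega)),
      smul_mul_assoc, smul_smul, mul_comm]

/-- Among the û_i only û_0 has nonzero d₂, which leaves the two end terms. -/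
theorem d_one_theta (n : ℕ) (f : ℕ → k) :
    W.d 1 (W.theta n f) = (f 0 + W.q12 ^ n * W.s * f n) • W.uHat n := by
  have e : (W.Q 0 1 : k) = W.q12 := rfl
  have e' : (W.Q 1 1 : k) = W.s := rfl
  simp only [theta_apply, map_sum, map_smul, W.d_mul, chiRight_uHat, smul_add,
    Finset.sum_add_distrib, e, e', add_smul]
  congr 1
  · rw [Finset.sum_range_succ', d_one_uHat_zero, one_mul, Nat.sub_zero, add_eq_right]
    exact Finset.sum_eq_zero fun i hi => by rw [d_one_uHat_succ, zero_mul, smul_zero]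
  · rw [Finset.sum_range_succ, Nat.sub_self, d_one_uHat_zero, mul_one, smul_smul, mul_comm (f n),
      add_eq_right]
    refine Finset.sum_eq_zero fun i hi => ?_
    have := Finset.mem_range.1 hi
    rw [show n - i = (n - i - 1) + 1 by omega, d_one_uHat_succ, mul_zero, smul_zero]

variable {W} in
theorem adX_theta {n : ℕ} (hn : W.norm (n + 1) ≠ 0) (f : ℕ → k) :
    W.adX (W.theta n f) = W.theta (n + 1) (alpha W.q W.q12 W.q21 (n + 1) f) := by
  have er : W.q12 * W.q21 = W.r := rfl
  simp only [theta_apply, map_sum, map_smul, W.adX_mul, chiLeft_uHat, smul_add,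
    Finset.sum_add_distrib, alpha, add_smul, er]
  congr 1
  · rw [Finset.sum_range_succ' _ (n + 1), cCoef_zero, zero_mul, zero_smul, add_zero]
    refine Finset.sum_congr rfl fun i hi => ?_
    have := Finset.mem_range.1 hi
    rw [adX_uHat (norm_ne_zero_of_le hn (by omega)), show i + 1 - 1 = i from rfl,
      Nat.add_sub_add_right,
      smul_mul_assoc, smul_smul, mul_comm]
  · rw [Finset.sum_range_succ _ (n + 1), Nat.sub_self, cCoef_zero, mul_zero, zero_mul, zero_smul,
      add_zero]
    refine Finset.sum_congr rfl fun i hi => ?_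
    have := Finset.mem_range.1 hi
    rw [Nat.sub_add_comm (by omega), adX_uHat (norm_ne_zero_of_le hn (by omega)),
      smul_mul_assoc, mul_smul_comm, smul_smul, smul_smul]
    congr 1
    ring

theorem exists_lastCoeff :
    ∃ F : TensorAlgebra k V →ₗ[k] k, ∀ n f, F (W.theta n f) = f n * (W.norm n)⁻¹ := by
  -- A representation with x₁ ↦ E₂₂ and x₂ ↦ E₁₀ + E₂₁, hence u_n ↦ E₂₁ for n ≥ 1. The entry (2, 0)
  -- of u_i u_j is then 1 for j = 0 and 0 otherwise, so it reads off the last coordinate.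
  let φ : TensorAlgebra k V →ₐ[k] Matrix (Fin 3) (Fin 3) k :=
    W.liftX ![!![0, 0, 0; 0, 0, 0; 0, 0, 1], !![0, 0, 0; 1, 0, 0; 0, 1, 0]]
  have h0 : φ (W.X 0) = !![0, 0, 0; 0, 0, 0; 0, 0, 1] := W.liftX_X _ 0
  have h1 : φ (W.u 0) = !![0, 0, 0; 1, 0, 0; 0, 1, 0] := W.liftX_X _ 1
  have hu : ∀ n, φ (W.u (n + 1)) = !![0, 0, 0; 0, 0, 0; 0, 1, 0] := by
    intro n
    induction n with
    | zero =>
      rw [u, map_sub, map_smul, map_mul, map_mul, h0, h1]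
      ext i j
      fin_cases i <;> fin_cases j <;> simp
    | succ n ih =>
      rw [u, map_sub, map_smul, map_mul, map_mul, h0, ih]
      ext i j
      fin_cases i <;> fin_cases j <;> simp
  refine ⟨(LinearMap.proj 0 ∘ₗ LinearMap.proj 2 : (Fin 3 → Fin 3 → k) →ₗ[k] k) ∘ₗ
    φ.toLinearMap, fun n f => ?_⟩
  change φ (W.theta n f) 2 0 = _
  have h2 : ∀ i, φ (W.u i * W.u 0) 2 0 = 1 := by
    intro i
    rw [map_mul, h1]
    cases i with
    | zero => simp [h1, Matrix.mul_apply, Fin.sum_univ_three]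
    | succ i => simp [hu, Matrix.mul_apply, Fin.sum_univ_three]
  have h3 : ∀ i j, φ (W.u i * W.u (j + 1)) 2 0 = 0 := by
    intro i j
    rw [map_mul, hu]
    cases i with
    | zero => simp [h1, Matrix.mul_apply, Fin.sum_univ_three]
    | succ i => simp [hu, Matrix.mul_apply, Fin.sum_univ_three]
  rw [theta_apply, Finset.sum_range_succ, map_add, Matrix.add_apply, Nat.sub_self, map_smul,
    uHat_zero, uHat_eq, smul_mul_assoc, map_smul, Matrix.smul_apply, Matrix.smul_apply, h2,
    smul_eq_mul, smul_eq_mul, mul_one, add_eq_right, map_sum, Matrix.sum_apply]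
  refine Finset.sum_eq_zero fun i hi => ?_
  have := Finset.mem_range.1 hi
  rw [map_smul, uHat_eq, uHat_eq, smul_mul_smul_comm, map_smul,
    show n - i = (n - i - 1) + 1 by omega,
    Matrix.smul_apply, Matrix.smul_apply, h3, smul_zero, smul_zero]

variable {W} in
-- By induction d₁ gives `tau f = 0`, and the last coordinate vanishes by `exists_lastCoeff`. The
-- recursion `tau f = 0` then runs downwards, since q and q₂₁ are invertible.
theorem theta_eq_zero {n : ℕ} (hn : W.norm n ≠ 0) {f : ℕ → k} (h : W.theta n f = 0) {i : ℕ}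
    (hi : i ≤ n) : f i = 0 := by
  induction n generalizing f i with
  | zero =>
    obtain ⟨F, hF⟩ := W.exists_lastCoeff
    have := hF 0 f
    rw [h, map_zero, W.norm_zero, inv_one, mul_one] at this
    rw [Nat.le_zero.1 hi, this]
  | succ n ih =>
    obtain ⟨F, hF⟩ := W.exists_lastCoeff
    have hlast := hF (n + 1) f
    rw [h, map_zero, eq_comm] at hlast
    have ht : ∀ i ≤ n, tau W.q W.q21 f i = 0 := fun i hi =>
      ih (norm_ne_zero_of_le hn n.le_succ) (by rw [← d_zero_theta_succ hn, h, map_zero]) hi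
    induction hi using Nat.decreasingInduction with
    | self => exact (mul_eq_zero.1 hlast).resolve_right (inv_ne_zero hn)
    | of_succ i hi hs =>
      have := ht i (by omega)
      rw [tau, hs, zero_add] at this
      exact (mul_eq_zero.1 this).resolve_left
        (mul_ne_zero (pow_ne_zero _ W.q_ne_zero) W.q21_ne_zero)

theorem theta_mem_U (n : ℕ) (f : ℕ → k) : W.theta n f ∈ W.U n := by
  rw [theta_apply]
  refine sum_mem fun i hi => Submodule.smul_mem _ _ ?_
  rw [uHat_eq, uHat_eq, smul_mul_smul_comm]
  exact Submodule.smul_mem _ _ (Submodule.subset_span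
    ⟨i, by have := Finset.mem_range.1 hi; omega, rfl⟩)

theorem theta_mem_U' {n : ℕ} {f : ℕ → k} (hf : f n = 0) : W.theta n f ∈ W.U' n := by
  rw [theta_apply, Finset.sum_range_succ, hf, zero_smul, add_zero]
  refine sum_mem fun i hi => Submodule.smul_mem _ _ ?_
  rw [uHat_eq, uHat_eq, smul_mul_smul_comm]
  exact Submodule.smul_mem _ _ (Submodule.subset_span ⟨i, Finset.mem_range.1 hi, rfl⟩)

variable {W} in
theorem u_mul_u_eq_theta {n i : ℕ} (hn : W.norm n ≠ 0) (hi : i ≤ n) :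
    W.u i * W.u (n - i) = W.theta n (Pi.single i (W.norm i * W.norm (n - i))) := by
  rw [theta_apply, Finset.sum_eq_single i, Pi.single_eq_same, uHat_eq, uHat_eq,
    smul_mul_smul_comm, smul_smul, ← mul_inv, mul_inv_cancel₀, one_smul]
  · exact mul_ne_zero (norm_ne_zero_of_le hn hi) (norm_ne_zero_of_le hn (Nat.sub_le n i))
  · intro j _ hj
    rw [Pi.single_eq_of_ne hj, zero_smul]
  · intro h
    exact absurd (Finset.mem_range.2 (by omega)) h

variable {W} in
theorem mem_U_iff {n : ℕ} (hn : W.norm n ≠ 0) {y : TensorAlgebra k V} :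
    y ∈ W.U n ↔ ∃ f, y = W.theta n f := by
  refine ⟨fun h => ?_, fun ⟨f, hf⟩ => hf ▸ W.theta_mem_U n f⟩
  suffices hle : W.U n ≤ LinearMap.range (W.theta n) by
    obtain ⟨f, hf⟩ := hle h
    exact ⟨f, hf.symm⟩
  refine Submodule.span_le.2 ?_
  rintro _ ⟨i, hi, rfl⟩
  exact ⟨_, (u_mul_u_eq_theta hn hi).symm⟩

variable {W} in
theorem mem_U'_iff {n : ℕ} (hn : W.norm n ≠ 0) {y : TensorAlgebra k V} :
    y ∈ W.U' n ↔ ∃ f : ℕ → k, f n = 0 ∧ y = W.theta n f := by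
  refine ⟨fun h => ?_, fun ⟨f, hf, e⟩ => e ▸ W.theta_mem_U' hf⟩
  suffices hle : W.U' n ≤ (LinearMap.ker (LinearMap.proj n : (ℕ → k) →ₗ[k] k)).map (W.theta n) by
    obtain ⟨f, hf, e⟩ := hle h
    exact ⟨f, hf, e.symm⟩
  refine Submodule.span_le.2 ?_
  rintro _ ⟨i, hi, rfl⟩
  exact ⟨_, Pi.single_eq_of_ne hi.ne' _, (u_mul_u_eq_theta hn hi.le).symm⟩

variable {W} in
-- The counit vanishes on U_n, and d₂ yields a multiple of û_n, which is not a relation.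
theorem toNichols_theta_eq_zero_iff {n : ℕ} (hn : W.norm n ≠ 0) (f : ℕ → k) :
    W.toNichols (W.theta n f) = 0 ↔
      f 0 + W.q12 ^ n * W.s * f n = 0 ∧ W.toNichols (W.d 0 (W.theta n f)) = 0 := by
  have hε : TensorAlgebra.algebraMapInv (W.theta n f) = 0 := by
    rw [theta_apply, map_sum]
    refine Finset.sum_eq_zero fun i _ => ?_
    rw [map_smul, map_mul, uHat_eq, map_smul, W.algebraMapInv_u, smul_zero, zero_mul, smul_zero]
  rw [W.toNichols_eq_zero_iff_d, Fin.forall_fin_two, d_one_theta, map_smul, smul_eq_zero,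
    or_iff_left (toNichols_uHat_ne_zero hn)]
  simp only [hε, true_and, and_comm]

variable {W} in
theorem toNichols_P_eq_zero_iff {n : ℕ} (hn : W.norm n ≠ 0) :
    W.toNichols (W.P n) = 0 ↔ W.q ^ (n * (n - 1) / 2) * (-W.r) ^ n * W.s = -1 := by
  have hd : W.d 0 (W.P n) = 0 := by
    rw [P_eq_theta]
    cases n with
    | zero => exact W.d_zero_theta_zero _
    | succ n =>
      rw [d_zero_theta_succ hn, W.theta_congr (g := 0) fun i _ => tau_eSeq _ _ i, map_zero]
  rw [P_eq_theta] at hd ⊢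
  rw [toNichols_theta_eq_zero_iff hn, hd, map_zero, eSeq_zero, eSeq, r,
    show -(W.q12 * W.q21) = W.q12 * -W.q21 by ring, mul_pow]
  simp only [and_true]
  constructor <;> intro h <;> linear_combination h

variable {W} in
theorem adX_pow_P {j t : ℕ} (h : W.norm (j + t) ≠ 0) :
    (W.adX ^ t) (W.P j) = W.theta (j + t) (betaSeq W.q W.q12 W.q21 j t) := by
  induction t with
  | zero => exact W.P_eq_theta j
  | succ t ih =>
    rw [pow_succ', Module.End.mul_apply, ih (norm_ne_zero_of_le h (by omega)),
      adX_theta (n := j + t) h]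
    rfl

variable {W} in
theorem toNichols_adX_theta {n : ℕ} {f : ℕ → k} (h : W.toNichols (W.theta n f) = 0) :
    W.toNichols (W.adX (W.theta n f)) = 0 := by
  have hc : W.chiLeft 0 (W.theta n f) = (W.q ^ n * W.q12 ^ 2) • W.theta n f := by
    simp only [theta_apply, map_sum, map_smul, map_mul, chiLeft_uHat, Finset.smul_sum]
    refine Finset.sum_congr rfl fun i hi => ?_
    have := Finset.mem_range.1 hi
    rw [smul_mul_smul_comm, smul_comm]
    congr 1
    rw [mul_mul_mul_comm, ← pow_add, Nat.add_sub_cancel' (by omega), sq]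
  rw [adX_apply, hc, map_sub, map_mul, map_mul, map_smul, h, mul_zero, smul_zero, zero_mul,
    sub_zero]

variable {W} in
theorem d_zero_adX_theta {n : ℕ} (hn : W.norm (n + 1) ≠ 0) (f : ℕ → k) :
    W.d 0 (W.adX (W.theta n f)) =
      (1 - W.q ^ (2 * n) * W.r ^ 2) • W.theta n f + W.q • W.adX (W.d 0 (W.theta n f)) := by
  rw [adX_theta hn, d_zero_theta_succ hn, W.theta_congr fun i hi => tau_alpha _ _ _ n f hi]
  change W.theta n ((1 - W.q ^ (2 * n) * W.r ^ 2) • f +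
    W.q • alpha W.q W.q12 W.q21 n (tau W.q W.q21 f)) = _
  rw [map_add, map_smul, map_smul]
  congr 2
  cases n with
  | zero =>
    rw [d_zero_theta_zero, map_zero, theta_apply, Finset.sum_range_one]
    simp [alpha, cCoef_zero]
  | succ n =>
    have hn' := norm_ne_zero_of_le hn n.succ.le_succ
    rw [d_zero_theta_succ hn', adX_theta hn']

end DiagonalBraidedPlane

end

noncomputable section

namespace DiagonalBraidedPlane

variable {k V : Type*} [Field k] [AddCommGroup V] [Module k V] {W : DiagonalBraidedPlane k V}

/-! ### The sets `𝕁`, `𝕁₁` and `𝕁₂` -/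

theorem qNumber_mul_sub_one (x : k) (n : ℕ) : qNumber x n * (x - 1) = x ^ n - 1 :=
  geom_sum_mul x n

theorem qNumber_one (n : ℕ) : qNumber (1 : k) n = n := by simp [qNumber]

theorem qNumber_ne_zero {m d : ℕ} (hm : W.norm m ≠ 0) (hd : 0 < d) (hdm : d ≤ m) :
    qNumber W.q d ≠ 0 := by
  obtain ⟨d, rfl⟩ := Nat.exists_eq_succ_of_ne_zero hd.ne'
  exact left_ne_zero_of_mul (cCoef_ne_zero hm hdm)

/-- Since (d)_q ≠ 0, q is not a nontrivial root of unity of order at most m. All uniqueness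
statements on partners rest on this. -/
theorem q_eq_one_of_pow {m d : ℕ} (hm : W.norm m ≠ 0) (hd : 0 < d) (hdm : d ≤ m)
    (h : W.q ^ d = 1) : W.q = 1 := by
  have h₁ := qNumber_mul_sub_one W.q d
  rw [h, sub_self] at h₁
  exact sub_eq_zero.1 ((mul_eq_zero.1 h₁).resolve_left (qNumber_ne_zero hm hd hdm))

theorem q_pow_sub_eq_one {i j : ℕ} (hij : i ≤ j) {x : k}
    (h₁ : W.q ^ i * x = 1) (h₂ : W.q ^ j * x = 1) : W.q ^ (j - i) = 1 := by
  have h : W.q ^ (j - i) * (W.q ^ i * x) = 1 := by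
    rw [← mul_assoc, ← pow_add, Nat.sub_add_cancel hij, h₂]
  rwa [h₁, mul_one] at h

theorem exists_mem_J_of_mem_J₂ {n : ℕ} (hn : n ∈ W.J₂) :
    ∃ j ∈ W.J, j < n ∧ W.q ^ (j + n - 1) * W.r ^ 2 = 1 ∧ ringChar k ∣ n - j := by
  obtain ⟨-, j, hj, hjn, he, ho⟩ := hn
  refine ⟨j, hj, hjn, ?_⟩
  rcases Nat.even_or_odd (n - j) with h | h
  · exact ⟨(he h).1, (Dvd.intro_left 2 rfl).trans (he h).2⟩
  · refine ⟨?_, (ho h).2⟩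
    have h₁ : j + n - 1 = (j + n - 1) / 2 * 2 := by
      obtain ⟨t, ht⟩ := h
      omega
    rw [h₁, pow_mul, ← mul_pow, (ho h).1, neg_one_sq]

/-- If q^{n+j-1} r² = 1, the q-number in the condition for 𝕁 has base 1, or base ±1 for odd n - j.
At base 1 it is an integer, whose vanishing is divisibility by p. At base -1 with odd length it
equals 1, so this case cannot occur. -/
theorem mem_J₁_or_mem_J₂ {n : ℕ} (hn : n ∈ W.J) : n ∈ W.J₁ ∨ n ∈ W.J₂ := by
  by_contra! H
  obtain ⟨h₁, h₂⟩ := H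
  obtain ⟨hs, hcond⟩ := (W.mem_J_iff n).1 hn
  have : ∃ j ∈ W.J, j < n ∧ W.q ^ (j + n - 1) * W.r ^ 2 = 1 := by
    by_contra! H
    exact h₁ ⟨hn, hs, H⟩
  obtain ⟨j, hj, hjn, hx⟩ := this
  refine h₂ ⟨hn, j, hj, hjn, fun he => ⟨hx, ?_⟩, fun ho => ?_⟩
  · have h := (hcond j hj hjn).1 he
    rw [hx, qNumber_one] at h
    obtain ⟨t, ht⟩ := he
    rw [show n - j = 2 * ((n - j) / 2) by omega]
    exact mul_dvd_mul_left 2 ((ringChar.spec k _).1 h)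
  · have h := (hcond j hj hjn).2 ho
    have h₁ : j + n - 1 = (j + n - 1) / 2 * 2 := by
      obtain ⟨t, ht⟩ := ho
      omega
    rw [h₁, pow_mul, ← mul_pow, sq_eq_one_iff] at hx
    rcases hx with hx | hx
    · rw [hx, qNumber, neg_one_geom_sum, if_neg (Nat.not_even_iff_odd.2 ho)] at h
      exact absurd h one_ne_zero
    · rw [hx, neg_neg, qNumber_one] at h
      exact ⟨hx, (ringChar.spec k _).1 h⟩

theorem notMem_J₂_of_mem_J₁ {n : ℕ} (hn : n ∈ W.J₁) : n ∉ W.J₂ := by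
  intro h
  obtain ⟨j, hj, hjn, hx, -⟩ := exists_mem_J_of_mem_J₂ h
  exact hn.2.2 j hj hjn hx

/-- Otherwise q = 1, and (n - j)_q = n - j would vanish in `k` because p divides n - j. -/
theorem q_pow_ne_one_of_mem_J₂ {m n d : ℕ} (hm : W.norm m ≠ 0) (hn : n ∈ W.J₂) (hnm : n ≤ m)
    (hd : 0 < d) (hdm : d ≤ m) : W.q ^ d ≠ 1 := by
  intro h
  have hq := q_eq_one_of_pow hm hd hdm h
  obtain ⟨j, hj, hjn, hx, hdvd⟩ := exists_mem_J_of_mem_J₂ hn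
  refine qNumber_ne_zero hm (Nat.sub_pos_of_lt hjn) (by omega) ?_
  rw [hq, qNumber_one]
  exact (ringChar.spec k _).2 hdvd

theorem mem_J₁_of_pow_eq_one {m n j : ℕ} (hm : W.norm m ≠ 0) (hnm : n ≤ m) (hj : j ∈ W.J)
    (hjn : j < n) (hx : W.q ^ (n + j - 1) * W.r ^ 2 = 1) : j ∈ W.J₁ := by
  refine (mem_J₁_or_mem_J₂ hj).resolve_right fun h => ?_
  obtain ⟨i, hi, hij, hy, -⟩ := exists_mem_J_of_mem_J₂ h
  refine q_pow_ne_one_of_mem_J₂ hm h (by omega) (show 0 < n - i by omega) (by omega) ?_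
  rw [← q_pow_sub_eq_one (by omega) hy hx]
  congr 1
  omega

/-- Two partners i < j give q^{j-i} = 1, hence q = 1 and r² = 1, and then i violates the condition
for j ∈ 𝕁₁. -/
theorem IsPartner.unique {m n i j : ℕ} (hm : W.norm m ≠ 0) (hnm : n ≤ m)
    (hi : W.IsPartner n i) (hj : W.IsPartner n j) : i = j := by
  wlog h : i < j generalizing i j with H
  · by_contra hne
    exact hne (H hj hi (by omega)).symm
  exfalso
  obtain ⟨hi, hin, hx⟩ := hi
  obtain ⟨hj, hjn, hy⟩ := hj
  have hq := q_pow_sub_eq_one (by omega) hx hy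
  rw [show n + j - 1 - (n + i - 1) = j - i by omega] at hq
  have hq' := q_eq_one_of_pow hm (by omega) (by omega) hq
  refine hj.2.2 i hi.1 h ?_
  rw [hq', one_pow] at hx ⊢
  exact hx

theorem exists_isPartner {m n : ℕ} (hm : W.norm m ≠ 0) (hnm : n ≤ m) (hn : n ∈ W.J₂) :
    ∃ j, W.IsPartner n j := by
  obtain ⟨j, hj, hjn, hx, -⟩ := exists_mem_J_of_mem_J₂ hn
  rw [add_comm] at hx
  exact ⟨j, mem_J₁_of_pow_eq_one hm hnm hj hjn hx, hjn, hx⟩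

theorem not_isPartner_of_isPartner {m n i j : ℕ} (hm : W.norm m ≠ 0) (hnm : n ≤ m) (hin : i < n)
    (hi : i ∈ W.J₂) (hj : W.IsPartner i j) : ¬ W.IsPartner n j := by
  rintro ⟨-, hjn, hx⟩
  refine q_pow_ne_one_of_mem_J₂ hm hi (by omega) (show 0 < n - i by omega) (by omega) ?_
  rw [← q_pow_sub_eq_one (by have := hj.2.1; omega) hj.2.2 hx]
  congr 1
  have := hj.2.1
  omega

/-- Under the first condition, membership in `𝕁` is a condition on the partner only. -/
theorem mem_J_iff_of_isPartner {m n : ℕ} (hm : W.norm m ≠ 0) (hnm : n ≤ m)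
    (hP : W.toNichols (W.P n) = 0) :
    n ∈ W.J ↔ ∀ j, W.IsPartner n j →
      psi W.q W.q21 n (betaSeq W.q W.q12 W.q21 j (n - j - 1)) = 0 := by
  rw [toNichols_P_eq_zero_iff (norm_ne_zero_of_le hm hnm)] at hP
  have hpsi : ∀ j < n, psi W.q W.q21 n (betaSeq W.q W.q12 W.q21 j (n - j - 1)) = 0 ↔ _ :=
    fun j hj => psi_betaSeq_eq_zero_iff W.q_ne_zero W.q21_ne_zero hj
      fun l hl => cCoef_ne_zero hm (hl.trans_le hnm)
  rw [mem_J_iff]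
  constructor
  · rintro ⟨-, h⟩ j ⟨hj, hjn, -⟩
    exact (hpsi j hjn).2 (h j hj.1 hjn)
  · intro H
    refine ⟨hP, fun j hj hjn => ?_⟩
    by_cases hx : W.q ^ (n + j - 1) * W.r ^ 2 = 1
    · exact (hpsi j hjn).1 (H j ⟨mem_J₁_of_pow_eq_one hm hnm hj hjn hx, hjn, hx⟩)
    · rw [add_comm] at hx
      have hjs := ((W.mem_J_iff j).1 hj).1
      -- The quotient of the first conditions for `n` and `j`. It says that the base of the
      -- q-number, raised to its length, is 1. The base itself is not 1 by `hx`, so the geometric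
      -- sum vanishes.
      have hprod : ∏ l ∈ Finset.Ico j n, -(W.q ^ l * W.r) = 1 := by
        have h₁ := eSeq_mul_tailProd W.q W.r hjn.le
        have h₂ : eSeq W.q W.r j * W.s = -1 := by rw [← hjs, eSeq]; ring
        have h₃ : eSeq W.q W.r n * W.s = -1 := by rw [← hP, eSeq]; ring
        change tailProd W.q W.r n j = 1
        rw [← h₁] at h₃
        linear_combination tailProd W.q W.r n j * h₂ - h₃
      obtain ⟨t, rfl⟩ := Nat.exists_eq_add_of_lt hjn
      have e₁ : j + t + 1 - j = t + 1 := by omega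
      obtain ⟨h, rfl | rfl⟩ := Nat.even_or_odd' t
      · have e₂ : (j + (j + 2 * h + 1) - 1) / 2 = j + h := by omega
        have e₃ : j + (j + 2 * h + 1) - 1 = (j + h) * 2 := by omega
        rw [e₁, e₂]
        refine ⟨fun he => absurd he (by simp), fun _ => ?_⟩
        rw [add_assoc, prod_Ico_neg_pow_of_odd] at hprod
        have key := qNumber_mul_sub_one (-(W.q ^ (j + h) * W.r)) (2 * h + 1)
        rw [hprod, sub_self] at key
        refine (mul_eq_zero.1 key).resolve_right fun e => hx ?_
        rw [e₃, pow_mul, ← mul_pow, ← neg_sq, sub_eq_zero.1 e, one_pow]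
      · have e₂ : j + (j + (2 * h + 1) + 1) - 1 = 2 * j + 2 * h + 1 := by omega
        have e₃ : (2 * h + 1 + 1) / 2 = h + 1 := by omega
        rw [e₁, e₂, e₃]
        refine ⟨fun _ => ?_, fun ho => absurd ho (by simp [Nat.even_add_one])⟩
        rw [show j + (2 * h + 1) + 1 = j + 2 * (h + 1) by ring, prod_Ico_neg_pow_of_even]
          at hprod
        rw [e₂] at hx
        have key := qNumber_mul_sub_one (W.q ^ (2 * j + 2 * h + 1) * W.r ^ 2) (h + 1)
        rw [hprod, sub_self] at key
        exact (mul_eq_zero.1 key).resolve_right fun e => hx (sub_eq_zero.1 e)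

/-! ### The elements `L_n` -/

theorem toNichols_P_of_mem_J {j : ℕ} (hj : W.norm j ≠ 0) (h : j ∈ W.J) :
    W.toNichols (W.P j) = 0 :=
  (toNichols_P_eq_zero_iff hj).2 ((W.mem_J_iff j).1 h).1

/-- The kernel of the first skew-derivation on `U_n`. -/
theorem theta_eq_smul_P {n : ℕ} (hn : W.norm n ≠ 0) {f : ℕ → k} (h : W.d 0 (W.theta n f) = 0) :
    W.theta n f = f 0 • W.P n := by
  rw [P_eq_theta, ← map_smul]
  refine W.theta_congr fun i hi => ?_
  rw [Pi.smul_apply, smul_eq_mul]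
  induction i with
  | zero => rw [eSeq_zero, mul_one]
  | succ i ih =>
    obtain ⟨n, rfl⟩ := Nat.exists_eq_succ_of_ne_zero (show n ≠ 0 by omega)
    rw [d_zero_theta_succ hn] at h
    have ht := theta_eq_zero (norm_ne_zero_of_le hn n.le_succ) h (show i ≤ n by omega)
    rw [tau, ih (by omega)] at ht
    rw [eSeq_succ]
    linear_combination ht

/-- The image under powers of `ad x₁` of relations in `U_n`. -/
theorem exists_theta_adX_pow {n t : ℕ} (hn : W.norm (n + t) ≠ 0) {f : ℕ → k} :
    ∃ g, (W.adX ^ t) (W.theta n f) = W.theta (n + t) g ∧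
      (W.toNichols (W.theta n f) = 0 → W.toNichols (W.theta (n + t) g) = 0) := by
  induction t with
  | zero => exact ⟨f, rfl, id⟩
  | succ t ih =>
    obtain ⟨g, hg, hg'⟩ := ih (norm_ne_zero_of_le hn (by omega))
    refine ⟨_, by rw [pow_succ', Module.End.mul_apply, hg, adX_theta (n := n + t) hn]; rfl,
      fun h => ?_⟩
    have := toNichols_adX_theta (hg' h)
    rwa [adX_theta (n := n + t) hn] at this

theorem toNichols_adX_pow_P {j t : ℕ} (h : W.norm (j + t) ≠ 0) (hj : j ∈ W.J) :
    W.toNichols ((W.adX ^ t) (W.P j)) = 0 := by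
  obtain ⟨g, hg, hg'⟩ := exists_theta_adX_pow (f := eSeq W.q W.q21) h
  rw [P_eq_theta, hg]
  refine hg' ?_
  rw [← P_eq_theta]
  exact toNichols_P_of_mem_J (norm_ne_zero_of_le h (Nat.le_add_right j t)) hj

theorem exists_tau_eq (g : ℕ → k) : ∃ f : ℕ → k, f 0 = 0 ∧ ∀ i, tau W.q W.q21 f i = g i :=
  ⟨fun n => Nat.rec 0 (fun i x => g i - W.q ^ i * W.q21 * x) n, rfl,
    fun i => sub_add_cancel (g i) _⟩

/-- Lift the coordinates of (ad x₁)^{n-j-1}(P_j) along `tau` starting from 0. The last entry is the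
value of `psi`, which is zero because n ∈ 𝕁. Both end coordinates vanish, so d₂ imposes no further
condition. -/
theorem exists_isL {m n : ℕ} (hm : W.norm m ≠ 0) (hnm : n ≤ m) (hn : n ∈ W.J₂) :
    ∃ L, W.IsL n L := by
  obtain ⟨j, hj⟩ := exists_isPartner hm hnm hn
  have hn' := norm_ne_zero_of_le hm hnm
  have hpsi := (mem_J_iff_of_isPartner hm hnm (toNichols_P_of_mem_J hn' hn.1)).1 hn.1 j hj
  obtain ⟨f, hf, hτ⟩ := exists_tau_eq (W := W) (betaSeq W.q W.q12 W.q21 j (n - j - 1))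
  have hfn : f n = 0 := by
    rw [← psi_congr _ _ fun i _ => hτ i, psi_tau, hf, mul_zero, sub_zero] at hpsi
    exact hpsi
  have hd : W.d 0 (W.theta n f) = (W.adX ^ (n - j - 1)) (W.P j) := by
    have hjn := hj.2.1
    obtain ⟨t, rfl⟩ := Nat.exists_eq_add_of_lt hjn
    rw [show j + t + 1 - j - 1 = t by omega] at hτ ⊢
    rw [d_zero_theta_succ hn', W.theta_congr fun i _ => hτ i,
      adX_pow_P (norm_ne_zero_of_le hn' (by omega))]
  refine ⟨(-W.q21) • W.theta n f, Submodule.smul_mem _ _ (W.theta_mem_U' hfn), ?_, j, hj, ?_⟩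
  · rw [map_smul, (toNichols_theta_eq_zero_iff hn' f).2, smul_zero]
    refine ⟨by rw [hf, hfn, mul_zero, add_zero], ?_⟩
    rw [hd]
    refine toNichols_adX_pow_P (norm_ne_zero_of_le hn' ?_) hj.1.1
    have := hj.2.1
    omega
  · rw [map_smul, smul_smul, hd, neg_mul_neg, inv_mul_cancel₀ W.q21_ne_zero, one_smul]

/-- The difference is killed by d₁, so it is a multiple of P_n. Its last coordinate is zero while
that of P_n is not. -/
theorem IsL.unique {m n : ℕ} (hm : W.norm m ≠ 0) (hnm : n ≤ m) {L L' : TensorAlgebra k V}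
    (h : W.IsL n L) (h' : W.IsL n L') : L = L' := by
  have hn' := norm_ne_zero_of_le hm hnm
  obtain ⟨hL, -, j, hj, hd⟩ := h
  obtain ⟨hL', -, j', hj', hd'⟩ := h'
  obtain rfl := hj.unique hm hnm hj'
  obtain ⟨f, hf, rfl⟩ := (mem_U'_iff hn').1 hL
  obtain ⟨f', hf', rfl⟩ := (mem_U'_iff hn').1 hL'
  have hdd : W.d 0 (W.theta n (f - f')) = 0 := by
    rw [map_sub, map_sub, sub_eq_zero]
    exact smul_right_injective _ (neg_ne_zero.2 (inv_ne_zero W.q21_ne_zero)) (hd.trans hd'.symm)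
  have h₁ := theta_eq_smul_P hn' hdd
  have h₂ : (f - f') 0 = 0 := by
    have h₃ : W.theta n (f - f' - (f - f') 0 • eSeq W.q W.q21) = 0 := by
      rw [map_sub, map_smul, ← P_eq_theta, h₁, sub_self]
    have h₄ := theta_eq_zero hn' h₃ le_rfl
    simp only [Pi.sub_apply, Pi.smul_apply, hf, hf', sub_self, smul_eq_mul, zero_sub,
      neg_eq_zero] at h₄
    exact (mul_eq_zero.1 h₄).resolve_right (eSeq_ne_zero W.q_ne_zero W.q21_ne_zero n)
  rw [h₂, zero_smul, map_sub, sub_eq_zero] at h₁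
  exact h₁

end DiagonalBraidedPlane

end

noncomputable section

namespace DiagonalBraidedPlane

variable {k V : Type*} [Field k] [AddCommGroup V] [Module k V] {W : DiagonalBraidedPlane k V}

/-! ### The basis of the relations in `U_m` -/

variable (W) in
/-- The relations of degree `n α₁ + 2 α₂`: the intersection of `ker π` and `U_n`. -/
def relations (n : ℕ) : Submodule k (TensorAlgebra k V) :=
  LinearMap.ker W.toNichols.toLinearMap ⊓ W.U n

theorem mem_relations_iff {n : ℕ} (hn : W.norm n ≠ 0) {y : TensorAlgebra k V} :
    y ∈ W.relations n ↔ ∃ f, y = W.theta n f ∧ W.toNichols (W.theta n f) = 0 := by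
  rw [relations, Submodule.mem_inf, mem_U_iff hn, LinearMap.mem_ker]
  constructor
  · rintro ⟨h, f, rfl⟩
    exact ⟨f, rfl, h⟩
  · rintro ⟨f, rfl, h⟩
    exact ⟨h, f, rfl⟩

theorem P_mem_relations {n : ℕ} (hn : W.norm n ≠ 0) (h : W.toNichols (W.P n) = 0) :
    W.P n ∈ W.relations n := by
  rw [P_eq_theta] at h ⊢
  exact (mem_relations_iff hn).2 ⟨_, rfl, h⟩

theorem IsL.mem_relations {n : ℕ} (hn : W.norm n ≠ 0) {L : TensorAlgebra k V} (h : W.IsL n L) :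
    L ∈ W.relations n := by
  obtain ⟨f, -, rfl⟩ := (mem_U'_iff hn).1 h.1
  exact (mem_relations_iff hn).2 ⟨f, rfl, h.2.1⟩

theorem adX_pow_mem_relations {n t : ℕ} (hn : W.norm (n + t) ≠ 0) {y : TensorAlgebra k V}
    (hy : y ∈ W.relations n) : (W.adX ^ t) y ∈ W.relations (n + t) := by
  obtain ⟨f, rfl, hf⟩ :=
    (mem_relations_iff (norm_ne_zero_of_le hn (Nat.le_add_right n t))).1 hy
  obtain ⟨g, hg, hg'⟩ := exists_theta_adX_pow (f := f) hn
  exact (mem_relations_iff hn).2 ⟨g, hg, hg' hf⟩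

theorem d_mem_relations {n : ℕ} (hn : W.norm (n + 1) ≠ 0) {y : TensorAlgebra k V}
    (hy : y ∈ W.relations (n + 1)) : W.d 0 y ∈ W.relations n := by
  obtain ⟨f, rfl, hf⟩ := (mem_relations_iff hn).1 hy
  have := W.toNichols_d hf 0
  rw [d_zero_theta_succ hn] at this ⊢
  exact (mem_relations_iff (norm_ne_zero_of_le hn n.le_succ)).2 ⟨_, rfl, this⟩

/-- Iterated commutation of d₁ with ad x₁. For `t = 0` the truncated exponent `t - 1` is harmless,
as its coefficient is zero. -/
theorem d_zero_adX_pow {n t : ℕ} (hn : W.norm (n + t) ≠ 0) {y : TensorAlgebra k V}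
    (hy : y ∈ W.U n) :
    W.d 0 ((W.adX ^ t) y) = cCoef W.q (W.q ^ (2 * n) * W.r ^ 2) t • (W.adX ^ (t - 1)) y +
      W.q ^ t • (W.adX ^ t) (W.d 0 y) := by
  obtain ⟨f, rfl⟩ := (mem_U_iff (norm_ne_zero_of_le hn (Nat.le_add_right n t))).1 hy
  induction t with
  | zero => simp [cCoef_zero]
  | succ t ih =>
    have hn' := norm_ne_zero_of_le hn (show n + t ≤ n + (t + 1) by omega)
    obtain ⟨g, hg, -⟩ := exists_theta_adX_pow (f := f) hn'
    rw [pow_succ', Module.End.mul_apply, hg, d_zero_adX_theta (n := n + t) hn, ← hg, ih hn',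
      Nat.add_sub_cancel, map_add, map_smul, map_smul, cCoef_succ, add_smul, smul_add, smul_smul,
      smul_smul, ← pow_succ', ← Module.End.mul_apply, ← Module.End.mul_apply, ← pow_succ',
      ← add_assoc]
    congr 2
    · congr 2
      ring
    · cases t with
      | zero => simp [cCoef_zero]
      | succ t => rw [Nat.add_sub_cancel]

/-! ### The proposed basis, its behaviour under d₁, spanning and independence. -/

section Family

variable (W) (L : ℕ → TensorAlgebra k V)

open Classical in
/-- The family of relations in `U_n` indexed by `𝕁`. -/
def family (n j : ℕ) : TensorAlgebra k V :=
  (W.adX ^ (n - j)) (if j ∈ W.J₁ then W.P j else L j)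

/-- The elements of `𝕁` up to `n`. -/
def index (n : ℕ) : Finset ℕ := ((Set.finite_Iic n).inter_of_right W.J).toFinset

theorem mem_index {n j : ℕ} : j ∈ W.index n ↔ j ∈ W.J ∧ j ≤ n := by
  rw [index, Set.Finite.mem_toFinset]
  rfl

variable {W L}

theorem family_of_mem_J₁ {n j : ℕ} (hj : j ∈ W.J₁) :
    W.family L n j = (W.adX ^ (n - j)) (W.P j) := by
  rw [family, if_pos hj]

theorem family_of_mem_J₂ {n j : ℕ} (hj : j ∈ W.J₂) :
    W.family L n j = (W.adX ^ (n - j)) (L j) := by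
  rw [family, if_neg fun h => notMem_J₂_of_mem_J₁ h hj]

theorem family_mem_relations {m n j : ℕ} (hm : W.norm m ≠ 0)
    (hL : ∀ n ∈ W.J₂, n ≤ m → W.IsL n (L n)) (hnm : n ≤ m) (hj : j ∈ W.index n) :
    W.family L n j ∈ W.relations n := by
  obtain ⟨hjJ, hjn⟩ := W.mem_index.1 hj
  have hn := norm_ne_zero_of_le hm hnm
  have hj' := norm_ne_zero_of_le hn hjn
  obtain ⟨t, rfl⟩ := Nat.exists_eq_add_of_le hjn
  rcases mem_J₁_or_mem_J₂ hjJ with h | h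
  · rw [family_of_mem_J₁ h, Nat.add_sub_cancel_left]
    exact adX_pow_mem_relations hn (P_mem_relations hj' (toNichols_P_of_mem_J hj' hjJ))
  · rw [family_of_mem_J₂ h, Nat.add_sub_cancel_left]
    exact adX_pow_mem_relations hn ((hL j h (hjn.trans hnm)).mem_relations hj')

theorem d_zero_family_of_mem_J₁ {n j : ℕ} (hn : W.norm (n + 1) ≠ 0) (hjn : j ≤ n + 1)
    (hj : j ∈ W.J₁) :
    W.d 0 (W.family L (n + 1) j) =
      cCoef W.q (W.q ^ (2 * j) * W.r ^ 2) (n + 1 - j) • W.family L n j := by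
  have hP : W.P j = W.theta j (eSeq W.q W.q21) := W.P_eq_theta j
  have hd : W.d 0 (W.P j) = 0 := by
    rw [hP]
    cases j with
    | zero => exact W.d_zero_theta_zero _
    | succ j =>
      rw [d_zero_theta_succ (norm_ne_zero_of_le hn hjn),
        W.theta_congr (g := 0) fun i _ => tau_eSeq _ _ i, map_zero]
  rw [family_of_mem_J₁ hj, family_of_mem_J₁ hj,
    d_zero_adX_pow (by rwa [Nat.add_sub_cancel' hjn]) (hP ▸ W.theta_mem_U _ _), hd, map_zero,
    smul_zero, add_zero, Nat.sub_right_comm, Nat.add_sub_cancel]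

/-- Together with `d_zero_family_of_mem_J₁` this makes d₁ triangular on the family: diagonal
scalars, plus one link from each L_i to its partner. -/
theorem d_zero_family_of_mem_J₂ {n i j : ℕ} (hn : W.norm (n + 1) ≠ 0) (hin : i ≤ n + 1)
    (hi : i ∈ W.J₂) (hL : W.IsL i (L i)) (hij : W.IsPartner i j) :
    W.d 0 (W.family L (n + 1) i) =
      cCoef W.q (W.q ^ (2 * i) * W.r ^ 2) (n + 1 - i) • W.family L n i +
        (W.q ^ (n + 1 - i) * -W.q21) • W.family L n j := by
  obtain ⟨hU, -, j', hj', hd⟩ := hL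
  obtain rfl := hj'.unique hn hin hij
  have hd' : W.d 0 (L i) = (-W.q21) • (W.adX ^ (i - j' - 1)) (W.P j') := by
    rw [← hd, smul_smul, neg_mul_neg, mul_inv_cancel₀ W.q21_ne_zero, one_smul]
  obtain ⟨f, -, hf⟩ := (mem_U'_iff (norm_ne_zero_of_le hn hin)).1 hU
  have hlt := hij.2.1
  rw [family_of_mem_J₂ hi, family_of_mem_J₂ hi, family_of_mem_J₁ hij.1,
    d_zero_adX_pow (by rwa [Nat.add_sub_cancel' hin]) (hf ▸ W.theta_mem_U _ _), hd', map_smul,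
    ← Module.End.mul_apply, ← pow_add, mul_smul, Nat.sub_right_comm, Nat.add_sub_cancel,
    show n + 1 - i + (i - j' - 1) = n - j' by omega]

/-- The coefficient in the derivative of the family vanishes only for partners. -/
theorem cCoef_eq_zero_iff {m n j : ℕ} (hm : W.norm m ≠ 0) (hnm : n ≤ m) (hj : j ∈ W.J)
    (hjn : j < n) :
    cCoef W.q (W.q ^ (2 * j) * W.r ^ 2) (n - j) = 0 ↔ W.IsPartner n j := by
  have h₁ : qNumber W.q (n - j) ≠ 0 := qNumber_ne_zero hm (by omega) (by omega)
  have h₂ : W.q ^ (n - j - 1) * (W.q ^ (2 * j) * W.r ^ 2) = W.q ^ (n + j - 1) * W.r ^ 2 := by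
    rw [← mul_assoc, ← pow_add]
    congr 2
    omega
  rw [qNumber] at h₁
  rw [cCoef, h₂, mul_eq_zero, or_iff_right h₁, sub_eq_zero, eq_comm]
  exact ⟨fun h => ⟨mem_J₁_of_pow_eq_one hm hnm hj hjn h, hjn, h⟩, fun h => h.2.2⟩

/-- The diagonal scalar of d₁ vanishes for a partner, so the element lies on the line ker d₁. Its
first coordinate is a product of nonzero factors by `betaSeq_zero`. -/
theorem adX_pow_P_eq_smul {m n j : ℕ} (hm : W.norm m ≠ 0) (hnm : n ≤ m) (hj : W.IsPartner n j) :
    ∃ c : k, c ≠ 0 ∧ (W.adX ^ (n - j)) (W.P j) = c • W.P n := by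
  have hn := norm_ne_zero_of_le hm hnm
  have hjn := hj.2.1
  obtain ⟨n, rfl⟩ : ∃ l, n = l + 1 := Nat.exists_eq_succ_of_ne_zero (by omega)
  have hd := d_zero_family_of_mem_J₁ (L := 0) hn hjn.le hj.1
  rw [(cCoef_eq_zero_iff hm hnm hj.1.1 hjn).2 hj, zero_smul, family_of_mem_J₁ hj.1] at hd
  have hP := adX_pow_P (j := j) (t := n + 1 - j) (W := W) (by rwa [Nat.add_sub_cancel' hjn.le])
  rw [Nat.add_sub_cancel' hjn.le] at hP
  rw [hP] at hd ⊢
  refine ⟨_, ?_, theta_eq_smul_P hn hd⟩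
  rw [betaSeq_zero, Finset.prod_ne_zero_iff]
  intro l hl
  have := Finset.mem_range.1 hl
  exact mul_ne_zero W.q12_ne_zero (cCoef_ne_zero hn (by omega))

theorem P_ne_zero {n : ℕ} (hn : W.norm n ≠ 0) : W.P n ≠ 0 := by
  rw [P_eq_theta]
  intro h
  have := theta_eq_zero hn h (Nat.zero_le n)
  rw [eSeq_zero] at this
  exact one_ne_zero this

theorem toNichols_P_of_isPartner {m n j : ℕ} (hm : W.norm m ≠ 0) (hnm : n ≤ m)
    (hj : W.IsPartner n j) : W.toNichols (W.P n) = 0 := by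
  obtain ⟨c, hc, h⟩ := adX_pow_P_eq_smul hm hnm hj
  have h₁ := toNichols_adX_pow_P (W := W) (j := j) (t := n - j)
    (by rw [Nat.add_sub_cancel' hj.2.1.le]; exact norm_ne_zero_of_le hm hnm) hj.1.1
  rw [h, map_smul, smul_eq_zero] at h₁
  exact h₁.resolve_left hc

theorem P_mem_span_family {m n : ℕ} (hm : W.norm m ≠ 0) (hnm : n ≤ m)
    (hP : W.toNichols (W.P n) = 0) :
    W.P n ∈ Submodule.span k (W.family L n '' W.index n) := by
  by_cases h : ∃ j, W.IsPartner n j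
  · obtain ⟨j, hj⟩ := h
    obtain ⟨c, hc, he⟩ := adX_pow_P_eq_smul hm hnm hj
    rw [show W.P n = c⁻¹ • (c • W.P n) by rw [smul_smul, inv_mul_cancel₀ hc, one_smul], ← he,
      ← family_of_mem_J₁ (L := L) hj.1]
    exact Submodule.smul_mem _ _ (Submodule.subset_span
      ⟨j, W.mem_index.2 ⟨hj.1.1, hj.2.1.le⟩, rfl⟩)
  · have hn : n ∈ W.J := (mem_J_iff_of_isPartner hm hnm hP).2 fun j hj => absurd ⟨j, hj⟩ h
    have hn₁ : n ∈ W.J₁ :=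
      (mem_J₁_or_mem_J₂ hn).resolve_right fun h' => h (exists_isPartner hm hnm h')
    have : W.P n = W.family L n n := by
      rw [family_of_mem_J₁ hn₁, Nat.sub_self, pow_zero, Module.End.one_apply]
    rw [this]
    exact Submodule.subset_span ⟨n, W.mem_index.2 ⟨hn, le_rfl⟩, rfl⟩

/-- A relation whose derivative is a multiple of `(ad x₁)^(n-j-1) (P_j)`, `j` the partner of
`n ∉ 𝕁`, has derivative zero. -/
theorem eq_zero_of_d_zero_eq_smul {m n j : ℕ} (hm : W.norm m ≠ 0) (hnm : n + 1 ≤ m)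
    (hn : n + 1 ∉ W.J) (hj : W.IsPartner (n + 1) j) {y : TensorAlgebra k V}
    (hy : y ∈ W.relations (n + 1)) {c : k} (hd : W.d 0 y = c • (W.adX ^ (n - j)) (W.P j)) :
    c = 0 := by
  have hn' := norm_ne_zero_of_le hm hnm
  have hjn := hj.2.1
  have hP := toNichols_P_of_isPartner hm hnm hj
  have hpsi : psi W.q W.q21 (n + 1) (betaSeq W.q W.q12 W.q21 j (n - j)) ≠ 0 := by
    intro h
    refine hn ((mem_J_iff_of_isPartner hm hnm hP).2 fun i hi => ?_)
    rw [hi.unique hm hnm hj, Nat.sub_right_comm, Nat.add_sub_cancel, h]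
  obtain ⟨f, rfl, hf⟩ := (mem_relations_iff hn').1 hy
  have h₁ := ((toNichols_theta_eq_zero_iff hn' f).1 hf).1
  rw [P_eq_theta] at hP
  have h₂ := ((toNichols_theta_eq_zero_iff hn' _).1 hP).1
  rw [eSeq_zero] at h₂
  have hA := adX_pow_P (W := W) (j := j) (t := n - j)
    (norm_ne_zero_of_le hn' (by omega))
  rw [Nat.add_sub_cancel' (by omega)] at hA
  rw [d_zero_theta_succ hn', hA, ← map_smul, ← sub_eq_zero, ← map_sub] at hd
  have h₃ : psi W.q W.q21 (n + 1) (tau W.q W.q21 f) =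
      c * psi W.q W.q21 (n + 1) (betaSeq W.q W.q12 W.q21 j (n - j)) := by
    rw [psi_congr _ _ (g := fun i => c * betaSeq W.q W.q12 W.q21 j (n - j) i)]
    · rw [psi, psi, Finset.mul_sum]
      exact Finset.sum_congr rfl fun i _ => by ring
    · intro i hi
      exact sub_eq_zero.1 (theta_eq_zero (norm_ne_zero_of_le hn' n.le_succ) hd
        (Nat.lt_succ_iff.1 hi))
  rw [psi_tau] at h₃
  refine (mul_eq_zero.1 (h₃.symm.trans ?_)).resolve_right hpsi
  -- Both the given relation and P_{n+1} satisfy the d₂-equation, so their pairs of end coordinates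
  -- are proportional and `psi (tau f) = 0`.
  linear_combination f (n + 1) * h₂ - eSeq W.q W.q21 (n + 1) * h₁

/-- The derivatives of the family span all members of the family in lower degree except possibly
the partner. -/
theorem family_mem_span_d_zero {m n j : ℕ} (hm : W.norm m ≠ 0)
    (hL : ∀ n ∈ W.J₂, n ≤ m → W.IsL n (L n)) (hnm : n + 1 ≤ m) (hj : j ∈ W.index n)
    (h : W.IsPartner (n + 1) j → n + 1 ∈ W.J) :
    W.family L n j ∈
      (Submodule.span k (W.family L (n + 1) '' W.index (n + 1))).map (W.d 0) := by
  have hn' := norm_ne_zero_of_le hm hnm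
  obtain ⟨hjJ, hjn⟩ := W.mem_index.1 hj
  set T := (Submodule.span k (W.family L (n + 1) '' W.index (n + 1))).map (W.d 0)
  have hT : ∀ i ∈ W.index (n + 1), W.d 0 (W.family L (n + 1) i) ∈ T := fun i hi =>
    Submodule.mem_map_of_mem (Submodule.subset_span ⟨i, hi, rfl⟩)
  have mem_of_smul : ∀ {c : k} {y : TensorAlgebra k V}, c ≠ 0 → c • y ∈ T → y ∈ T :=
    fun hc hy => (Submodule.smul_mem_iff _ hc).1 hy
  have hidx : ∀ {i}, i ∈ W.J → i ≤ n + 1 → i ∈ W.index (n + 1) := fun h h' =>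
    W.mem_index.2 ⟨h, h'⟩
  have key : ∀ i ∈ W.J₁, i ≤ n → ¬ W.IsPartner (n + 1) i → W.family L n i ∈ T := by
    intro i hi hin hip
    have := hT i (hidx hi.1 (by omega))
    rw [d_zero_family_of_mem_J₁ hn' (by omega) hi] at this
    exact mem_of_smul (mt (cCoef_eq_zero_iff hm hnm hi.1 (by omega)).1 hip) this
  -- The partner of `n + 1` is not reached from its own successor, whose derivative is zero, but
  -- L_{n+1} has it as derivative up to a nonzero scalar.
  by_cases hp : W.IsPartner (n + 1) j
  · have hn₂ : n + 1 ∈ W.J₂ := (mem_J₁_or_mem_J₂ (h hp)).resolve_left fun h₁ =>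
      h₁.2.2 j hp.1.1 hp.2.1 (by rw [add_comm j]; exact hp.2.2)
    have := hT (n + 1) (hidx (h hp) le_rfl)
    rw [d_zero_family_of_mem_J₂ hn' le_rfl hn₂ (hL _ hn₂ hnm) hp, Nat.sub_self, cCoef_zero,
      zero_smul, zero_add] at this
    exact mem_of_smul (mul_ne_zero (pow_ne_zero _ W.q_ne_zero) (neg_ne_zero.2 W.q21_ne_zero)) this
  · rcases mem_J₁_or_mem_J₂ hjJ with h₁ | h₂
    · exact key j h₁ hjn hp
    · obtain ⟨i, hi⟩ := exists_isPartner hm (hjn.trans (by omega)) h₂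
      have hij := hi.2.1
      have := hT j (hidx hjJ (by omega))
      rw [d_zero_family_of_mem_J₂ hn' (by omega) h₂ (hL _ h₂ (by omega)) hi] at this
      refine mem_of_smul (mt (cCoef_eq_zero_iff hm hnm hjJ (by omega)).1 hp)
        ((Submodule.add_mem_iff_left _ (Submodule.smul_mem _ _ ?_)).1 this)
      exact key i hi.1 (by omega) (not_isPartner_of_isPartner hm hnm (by omega) h₂ hi)

/-- By induction the derivative of a relation lies in the span one degree lower. Once it is matched
by the derivative of an element `z` of the span, `y - z` is a multiple of P_{n+1}. -/
theorem relations_le_span_family {m n : ℕ} (hm : W.norm m ≠ 0)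
    (hL : ∀ n ∈ W.J₂, n ≤ m → W.IsL n (L n)) (hnm : n ≤ m) :
    W.relations n ≤ Submodule.span k (W.family L n '' W.index n) := by
  induction n with
  | zero =>
    intro y hy
    obtain ⟨f, rfl, hf⟩ := (mem_relations_iff (norm_ne_zero_of_le hm hnm)).1 hy
    have h₁ := theta_eq_smul_P (norm_ne_zero_of_le hm hnm) (W.d_zero_theta_zero f)
    rw [h₁, map_smul, smul_eq_zero] at hf
    rw [h₁]
    rcases hf with hf | hf
    · rw [hf, zero_smul]
      exact zero_mem _
    · exact Submodule.smul_mem _ _ (P_mem_span_family hm hnm hf)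
  | succ n ih =>
    have hn' := norm_ne_zero_of_le hm hnm
    have hle : Submodule.span k (W.family L (n + 1) '' W.index (n + 1)) ≤ W.relations (n + 1) := by
      refine Submodule.span_le.2 ?_
      rintro _ ⟨j, hj, rfl⟩
      exact family_mem_relations hm hL hnm hj
    have hd : ∀ y ∈ W.relations (n + 1), W.d 0 y ∈
        (Submodule.span k (W.family L (n + 1) '' W.index (n + 1))).map (W.d 0) := by
      intro y hy
      have hy' := ih (by omega) (d_mem_relations hn' hy)
      -- Here the partner's member has no preimage in the span. Its coefficient in the derivative of
      -- a relation vanishes, because `psi` does not vanish on it.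
      by_cases hp : ∃ j, W.IsPartner (n + 1) j ∧ n + 1 ∉ W.J
      · obtain ⟨j, hj, hnJ⟩ := hp
        have hle' : Submodule.span k (W.family L n '' W.index n) ≤
            (Submodule.span k (W.family L (n + 1) '' W.index (n + 1))).map (W.d 0) ⊔
              Submodule.span k {W.family L n j} := by
          refine Submodule.span_le.2 ?_
          rintro _ ⟨i, hi, rfl⟩
          by_cases hij : i = j
          · subst hij
            exact Submodule.mem_sup_right (Submodule.mem_span_singleton_self _)
          · exact Submodule.mem_sup_left (family_mem_span_d_zero hm hL hnm hi
              fun h => absurd (h.unique hm hnm hj) hij)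
        obtain ⟨_, ⟨z, hz, rfl⟩, c, hc, hzc⟩ := Submodule.mem_sup.1 (hle' hy')
        obtain ⟨c, rfl⟩ := Submodule.mem_span_singleton.1 hc
        have h₁ : W.d 0 (y - z) = c • (W.adX ^ (n - j)) (W.P j) := by
          rw [map_sub, ← hzc, add_sub_cancel_left, family_of_mem_J₁ hj.1]
        have h₂ := eq_zero_of_d_zero_eq_smul hm hnm hnJ hj (sub_mem hy (hle hz)) h₁
        rw [← hzc, h₂, zero_smul, add_zero]
        exact Submodule.mem_map_of_mem hz
      · push Not at hp
        refine Submodule.span_le.2 ?_ hy'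
        rintro _ ⟨i, hi, rfl⟩
        exact family_mem_span_d_zero hm hL hnm hi fun h => hp i h
    intro y hy
    obtain ⟨z, hz, hzy⟩ := hd y hy
    obtain ⟨f, hf, hf'⟩ := (mem_relations_iff hn').1 (sub_mem hy (hle hz))
    have h₁ : W.d 0 (W.theta (n + 1) f) = 0 := by rw [← hf, map_sub, hzy, sub_self]
    rw [theta_eq_smul_P hn' h₁] at hf hf'
    rw [← sub_add_cancel y z, hf]
    refine add_mem ?_ hz
    rw [map_smul, smul_eq_zero] at hf'
    rcases hf' with h | h
    · rw [h, zero_smul]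
      exact zero_mem _
    · exact Submodule.smul_mem _ _ (P_mem_span_family hm hnm h)

theorem exists_dual_of_linearIndepOn {E : Type*} [AddCommGroup E] [Module k E] {s : Finset ℕ}
    {v : ℕ → E} (h : LinearIndepOn k v (s : Set ℕ)) {i : ℕ} (hi : i ∈ s) :
    ∃ F : E →ₗ[k] k, F (v i) = 1 ∧ ∀ j ∈ s, j ≠ i → F (v j) = 0 := by
  let b := Module.Basis.span h
  obtain ⟨F, hF⟩ := LinearMap.exists_extend (b.coord ⟨i, hi⟩)
  have hb : ∀ j : (s : Set ℕ), F (v j) = b.coord ⟨i, hi⟩ (b j) := by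
    intro j
    rw [← hF, LinearMap.comp_apply, Submodule.subtype_apply, Module.Basis.span_apply h]
  refine ⟨F, ?_, fun j hj hne => ?_⟩
  · rw [hb ⟨i, hi⟩, Module.Basis.coord_apply, Module.Basis.repr_self, Finsupp.single_eq_same]
  · rw [hb ⟨j, hj⟩, Module.Basis.coord_apply, Module.Basis.repr_self, Finsupp.single_eq_of_ne]
    exact fun e => hne (congrArg Subtype.val e).symm

/-- Apply d₁ and functionals dual to the family one degree lower. Coefficients at 𝕁₂ come first,
since members at 𝕁₂ occur in derivatives only on the diagonal. The single term invisible to d₁ is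
the partner's member, or P_{n+1} itself if there is no partner, and it is a nonzero multiple of
P_{n+1}. -/
theorem linearIndepOn_family {m n : ℕ} (hm : W.norm m ≠ 0)
    (hL : ∀ n ∈ W.J₂, n ≤ m → W.IsL n (L n)) (hnm : n ≤ m) :
    LinearIndepOn k (W.family L n) (W.index n : Set ℕ) := by
  induction n with
  | zero =>
    rw [linearIndepOn_finset_iff]
    intro c hc j hj
    obtain ⟨hjJ, hj0⟩ := W.mem_index.1 hj
    obtain rfl := Nat.le_zero.1 hj0
    have h₁ : (0 : ℕ) ∈ W.J₁ :=
      ⟨hjJ, ((W.mem_J_iff 0).1 hjJ).1, fun n _ h => absurd h (Nat.not_lt_zero n)⟩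
    rw [Finset.sum_eq_single_of_mem 0 hj fun i hi hi0 =>
      absurd (Nat.le_zero.1 (W.mem_index.1 hi).2) hi0, family_of_mem_J₁ h₁] at hc
    exact (smul_eq_zero.1 hc).resolve_right (P_ne_zero (norm_ne_zero_of_le hm hnm))
  | succ n ih =>
    specialize ih (by omega)
    have hn' := norm_ne_zero_of_le hm hnm
    rw [linearIndepOn_finset_iff]
    intro c hc
    have hidx : ∀ {i}, i ∈ W.J → i ≤ n → i ∈ W.index n := fun h h' => W.mem_index.2 ⟨h, h'⟩
    have hlt : ∀ {i}, i ∈ W.index (n + 1) → i ≠ n + 1 → i ≤ n := fun h h' => by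
      have := (W.mem_index.1 h).2
      omega
    have hsum : ∀ F : TensorAlgebra k V →ₗ[k] k,
        ∑ j ∈ W.index (n + 1), c j * F (W.d 0 (W.family L (n + 1) j)) = 0 := by
      intro F
      have := congrArg (F ∘ₗ W.d 0) hc
      simpa using this
    -- the coefficients with index in `𝕁₂`
    have hc₂ : ∀ i ∈ W.J₂, i ≤ n → c i = 0 := by
      intro i hi hin
      obtain ⟨F, hF₁, hF₀⟩ := exists_dual_of_linearIndepOn ih (hidx hi.1 hin)
      have hs := hsum F
      have hne : ∀ l ∈ W.J₁, l ≤ n → F (W.family L n l) = 0 := fun l hl hln =>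
        hF₀ l (hidx hl.1 hln) fun e => notMem_J₂_of_mem_J₁ hl (e ▸ hi)
      have hterm : ∀ j ∈ W.index (n + 1), F (W.d 0 (W.family L (n + 1) j)) =
          cCoef W.q (W.q ^ (2 * j) * W.r ^ 2) (n + 1 - j) * F (W.family L n j) := by
        intro j hj
        obtain ⟨hjJ, hjn⟩ := W.mem_index.1 hj
        rcases mem_J₁_or_mem_J₂ hjJ with h₁ | h₂
        · rw [d_zero_family_of_mem_J₁ hn' hjn h₁, map_smul, smul_eq_mul]
        · obtain ⟨l, hl⟩ := exists_isPartner hm (hjn.trans hnm) h₂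
          have := hl.2.1
          rw [d_zero_family_of_mem_J₂ hn' hjn h₂ (hL _ h₂ (hjn.trans hnm)) hl, map_add, map_smul,
            map_smul, hne l hl.1 (by omega), smul_zero, add_zero, smul_eq_mul]
      have hiS : i ∈ W.index (n + 1) := W.mem_index.2 ⟨hi.1, by omega⟩
      rw [Finset.sum_eq_single_of_mem i hiS, hterm i hiS, hF₁, mul_one] at hs
      · refine (mul_eq_zero.1 hs).resolve_right (mt (cCoef_eq_zero_iff hm hnm hi.1 (by omega)).1 ?_)
        exact fun h => notMem_J₂_of_mem_J₁ h.1 hi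
      · intro j hj hji
        rw [hterm j hj]
        by_cases hjn : j = n + 1
        · rw [hjn, Nat.sub_self, cCoef_zero, zero_mul, mul_zero]
        · rw [hF₀ j (hidx (W.mem_index.1 hj).1 (hlt hj hjn)) hji, mul_zero, mul_zero]
    -- the coefficients with index in `𝕁₁`
    have hterm₁ : ∀ i ∈ W.J₁, i ≤ n → ∀ F : TensorAlgebra k V →ₗ[k] k,
        (∀ j ∈ W.index n, j ≠ i → F (W.family L n j) = 0) →
        ∀ j ∈ W.index (n + 1), j ≠ i → ¬ (j = n + 1 ∧ W.IsPartner (n + 1) i) →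
          c j * F (W.d 0 (W.family L (n + 1) j)) = 0 := by
      intro i hi hin F hF₀ j hj hji hjp
      obtain ⟨hjJ, hjn⟩ := W.mem_index.1 hj
      rcases mem_J₁_or_mem_J₂ hjJ with h₁ | h₂
      · rw [d_zero_family_of_mem_J₁ hn' hjn h₁, map_smul]
        by_cases hjn' : j = n + 1
        · rw [hjn', Nat.sub_self, cCoef_zero, zero_smul, mul_zero]
        · rw [hF₀ j (hidx hjJ (hlt hj hjn')) hji, smul_zero, mul_zero]
      · by_cases hjn' : j = n + 1
        · subst hjn'
          obtain ⟨l, hl⟩ := exists_isPartner hm hnm h₂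
          have := hl.2.1
          rw [d_zero_family_of_mem_J₂ hn' le_rfl h₂ (hL _ h₂ hnm) hl, Nat.sub_self, cCoef_zero,
            zero_smul, zero_add, map_smul, hF₀ l (hidx hl.1.1 (by omega)), smul_zero, mul_zero]
          rintro rfl
          exact hjp ⟨rfl, hl⟩
        · rw [hc₂ j h₂ (hlt hj hjn'), zero_mul]
    have hc₁ : ∀ i ∈ W.J₁, i ≤ n → ¬ W.IsPartner (n + 1) i → c i = 0 := by
      intro i hi hin hip
      obtain ⟨F, hF₁, hF₀⟩ := exists_dual_of_linearIndepOn ih (hidx hi.1 hin)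
      have hs := hsum F
      rw [Finset.sum_eq_single_of_mem i (W.mem_index.2 ⟨hi.1, by omega⟩) fun j hj hji =>
        hterm₁ i hi hin F hF₀ j hj hji fun h => hip h.2,
        d_zero_family_of_mem_J₁ hn' (by omega) hi, map_smul, hF₁, smul_eq_mul, mul_one] at hs
      exact (mul_eq_zero.1 hs).resolve_right
        (mt (cCoef_eq_zero_iff hm hnm hi.1 (by omega)).1 hip)
    by_cases hp : ∃ i, W.IsPartner (n + 1) i
    · obtain ⟨i, hi⟩ := hp
      have hin : i ≤ n := by have := hi.2.1; omega
      have hiS : i ∈ W.index (n + 1) := W.mem_index.2 ⟨hi.1.1, by omega⟩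
      -- The functional dual to the partner `i` isolates `c (n + 1)`: the diagonal scalar at `i` is
      -- zero, while L_{n+1} contributes -q₂₁.
      have hcn : n + 1 ∈ W.J → c (n + 1) = 0 := by
        intro hn
        have hn₂ : n + 1 ∈ W.J₂ := (mem_J₁_or_mem_J₂ hn).resolve_left fun h₁ =>
          h₁.2.2 i hi.1.1 hi.2.1 (by rw [add_comm i]; exact hi.2.2)
        obtain ⟨F, hF₁, hF₀⟩ := exists_dual_of_linearIndepOn ih (hidx hi.1.1 hin)
        have hs := hsum F
        rw [Finset.sum_eq_single_of_mem (n + 1) (W.mem_index.2 ⟨hn, le_rfl⟩),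
          d_zero_family_of_mem_J₂ hn' le_rfl hn₂ (hL _ hn₂ hnm) hi, Nat.sub_self, cCoef_zero,
          zero_smul, zero_add, map_smul, hF₁, smul_eq_mul, mul_one] at hs
        · exact (mul_eq_zero.1 hs).resolve_right
            (mul_ne_zero (pow_ne_zero _ W.q_ne_zero) (neg_ne_zero.2 W.q21_ne_zero))
        · intro j hj hjn
          by_cases hji : j = i
          · rw [hji, d_zero_family_of_mem_J₁ hn' (by omega) hi.1,
              (cCoef_eq_zero_iff hm hnm hi.1.1 hi.2.1).2 hi, zero_smul, map_zero, mul_zero]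
          · exact hterm₁ i hi.1 hin F hF₀ j hj hji fun h => hjn h.1
      have hother : ∀ j ∈ W.index (n + 1), j ≠ i → c j = 0 := by
        intro j hj hji
        by_cases hjn : j = n + 1
        · subst hjn
          exact hcn (W.mem_index.1 hj).1
        · rcases mem_J₁_or_mem_J₂ (W.mem_index.1 hj).1 with h₁ | h₂
          · exact hc₁ j h₁ (hlt hj hjn) fun h => hji (h.unique hm hnm hi)
          · exact hc₂ j h₂ (hlt hj hjn)
      intro j hj
      by_cases hji : j = i
      · subst hji
        rw [Finset.sum_eq_single_of_mem j hj fun l hl hlj => by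
          rw [hother l hl hlj, zero_smul], family_of_mem_J₁ hi.1] at hc
        obtain ⟨a, ha, he⟩ := adX_pow_P_eq_smul hm hnm hi
        rw [he] at hc
        exact (smul_eq_zero.1 hc).resolve_right (smul_ne_zero ha (P_ne_zero hn'))
      · exact hother j hj hji
    · have hother : ∀ j ∈ W.index (n + 1), j ≠ n + 1 → c j = 0 := by
        intro j hj hjn
        rcases mem_J₁_or_mem_J₂ (W.mem_index.1 hj).1 with h₁ | h₂
        · exact hc₁ j h₁ (hlt hj hjn) fun h => hp ⟨j, h⟩
        · exact hc₂ j h₂ (hlt hj hjn)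
      intro j hj
      by_cases hjn : j = n + 1
      · subst hjn
        have h₁ : n + 1 ∈ W.J₁ := (mem_J₁_or_mem_J₂ (W.mem_index.1 hj).1).resolve_right
          fun h => hp (exists_isPartner hm hnm h)
        rw [Finset.sum_eq_single_of_mem (n + 1) hj fun l hl hlj => by
          rw [hother l hl hlj, zero_smul], family_of_mem_J₁ h₁, Nat.sub_self, pow_zero,
          Module.End.one_apply] at hc
        exact (smul_eq_zero.1 hc).resolve_right (P_ne_zero hn')
      · exact hother j hj hjn

variable (W) in
/-- The index in `𝕁` of an element of the basis. -/
def toIndex (m : ℕ) :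
    {j : ℕ // j ∈ W.J₁ ∧ j ≤ m} ⊕ {n : ℕ // n ∈ W.J₂ ∧ n ≤ m} → (W.index m : Set ℕ) :=
  Sum.elim (fun j => ⟨j, W.mem_index.2 ⟨j.2.1.1, j.2.2⟩⟩)
    (fun n => ⟨n, W.mem_index.2 ⟨n.2.1.1, n.2.2⟩⟩)

theorem toIndex_bijective (m : ℕ) : Function.Bijective (W.toIndex m) := by
  constructor
  · rintro (⟨i, hi⟩ | ⟨i, hi⟩) (⟨j, hj⟩ | ⟨j, hj⟩) h <;>
      obtain rfl : i = j := congrArg Subtype.val h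
    · rfl
    · exact absurd hj.1 (notMem_J₂_of_mem_J₁ hi.1)
    · exact absurd hi.1 (notMem_J₂_of_mem_J₁ hj.1)
    · rfl
  · rintro ⟨j, hj⟩
    obtain ⟨hjJ, hjm⟩ := W.mem_index.1 hj
    rcases mem_J₁_or_mem_J₂ hjJ with h | h
    · exact ⟨Sum.inl ⟨j, h, hjm⟩, rfl⟩
    · exact ⟨Sum.inr ⟨j, h, hjm⟩, rfl⟩

theorem exists_basis_relations {m : ℕ} (hm : W.norm m ≠ 0)
    (hL : ∀ n ∈ W.J₂, n ≤ m → W.IsL n (L n)) :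
    ∃ B : Module.Basis ({j : ℕ // j ∈ W.J₁ ∧ j ≤ m} ⊕ {n : ℕ // n ∈ W.J₂ ∧ n ≤ m}) k
        ↥(W.relations m),
      ∀ i, (B i : TensorAlgebra k V) = W.family L m (W.toIndex m i) := by
  let v (i : {j : ℕ // j ∈ W.J₁ ∧ j ≤ m} ⊕ {n : ℕ // n ∈ W.J₂ ∧ n ≤ m}) : ↥(W.relations m) :=
    ⟨W.family L m (W.toIndex m i), family_mem_relations hm hL le_rfl (W.toIndex m i).2⟩
  have hli : LinearIndependent k v := by
    refine LinearIndependent.of_comp (W.relations m).subtype ?_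
    exact (linearIndepOn_family hm hL le_rfl).comp (W.toIndex m) (toIndex_bijective m).1
  have hsp : ⊤ ≤ Submodule.span k (Set.range v) := by
    rintro ⟨y, hy⟩ -
    have h₁ := relations_le_span_family hm hL le_rfl hy
    have h₂ : W.family L m '' W.index m = (W.relations m).subtype '' Set.range v := by
      rw [← Set.range_comp]
      ext z
      constructor
      · rintro ⟨j, hj, rfl⟩
        obtain ⟨i, hi⟩ := (toIndex_bijective m).2 ⟨j, hj⟩
        exact ⟨i, congrArg (fun x : (W.index m : Set ℕ) => W.family L m x) hi⟩
      · rintro ⟨i, rfl⟩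
        exact ⟨_, (W.toIndex m i).2, rfl⟩
    rw [h₂, Submodule.span_image] at h₁
    obtain ⟨z, hz, he⟩ := h₁
    rwa [show z = ⟨y, hy⟩ from Subtype.ext he] at hz
  exact ⟨Module.Basis.mk hli hsp, fun i => by rw [Module.Basis.mk_apply]⟩

theorem finrank_relations {m : ℕ} (hm : W.norm m ≠ 0) :
    Module.finrank k ↥(W.relations m) = (W.J ∩ Set.Icc 0 m).ncard := by
  -- The dimension does not depend on a given choice of the L_n, so one is chosen, with value 0
  -- outside the relevant indices.
  have hL : ∀ n, ∃ L, n ∈ W.J₂ → n ≤ m → W.IsL n L := by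
    intro n
    by_cases h : n ∈ W.J₂ ∧ n ≤ m
    · obtain ⟨L, hL⟩ := exists_isL hm h.2 h.1
      exact ⟨L, fun _ _ => hL⟩
    · exact ⟨0, fun h₁ h₂ => absurd ⟨h₁, h₂⟩ h⟩
  choose L hL using hL
  obtain ⟨B, -⟩ := exists_basis_relations hm hL
  have hset : W.J ∩ Set.Icc 0 m = (W.index m : Set ℕ) := by
    ext j
    rw [Finset.mem_coe, mem_index, Set.mem_inter_iff, Set.mem_Icc]
    simp
  rw [Module.finrank_eq_nat_card_basis B, Nat.card_eq_of_bijective _ (toIndex_bijective m), hset]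
  rfl

end Family

end DiagonalBraidedPlane
end

theorem mainTheorem1 {k V : Type*} [Field k] [AddCommGroup V] [Module k V]
    (W : DiagonalBraidedPlane k V) (m : ℕ)
    (hm : qFactorial W.q m * bProd W.q W.r m ≠ 0) :
    (∀ n ∈ W.J₂, n ≤ m → (∃! j, W.IsPartner n j) ∧ (∃! L, W.IsL n L)) ∧
    (∀ L : ℕ → TensorAlgebra k V, (∀ n ∈ W.J₂, n ≤ m → W.IsL n (L n)) →
      ∃ B : Module.Basis ({j : ℕ // j ∈ W.J₁ ∧ j ≤ m} ⊕ {n : ℕ // n ∈ W.J₂ ∧ n ≤ m}) k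
          ↥(LinearMap.ker W.toNichols.toLinearMap ⊓ W.U m),
        (∀ j : {j : ℕ // j ∈ W.J₁ ∧ j ≤ m},
          (B (Sum.inl j) : TensorAlgebra k V) = (W.adX ^ (m - (j : ℕ))) (W.P j)) ∧
        (∀ n : {n : ℕ // n ∈ W.J₂ ∧ n ≤ m},
          (B (Sum.inr n) : TensorAlgebra k V) = (W.adX ^ (m - (n : ℕ))) (L n))) ∧
    Module.finrank k ↥(LinearMap.ker W.toNichols.toLinearMap ⊓ W.U m) =
      (W.J ∩ Set.Icc 0 m).ncard := by
  have hm' : W.norm m ≠ 0 := hm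
  refine ⟨fun n hn hnm => ⟨?_, ?_⟩, fun L hL => ?_, DiagonalBraidedPlane.finrank_relations hm'⟩
  · obtain ⟨j, hj⟩ := DiagonalBraidedPlane.exists_isPartner hm' hnm hn
    exact ⟨j, hj, fun i hi => hi.unique hm' hnm hj⟩
  · obtain ⟨L, hL⟩ := DiagonalBraidedPlane.exists_isL hm' hnm hn
    exact ⟨L, hL, fun L' hL' => hL'.unique hm' hnm hL⟩
  · obtain ⟨B, hB⟩ := DiagonalBraidedPlane.exists_basis_relations hm' hL
    refine ⟨B, fun j => ?_, fun n => ?_⟩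
    · exact (hB (Sum.inl j)).trans (DiagonalBraidedPlane.family_of_mem_J₁ j.2.1)
    · exact (hB (Sum.inr n)).trans (DiagonalBraidedPlane.family_of_mem_J₂ n.2.1)
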